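/- Let $M$ be a smooth (finite-dimensional, Hausdorff, second countable) manifold, let $\pi: TM\setminus 0\to M$ be its tangent bundle without the null section, and let $p:\mathscr{V}TM=\ker d\pi\to TM\setminus 0$ be the vertical bundle. For $w\in TM\setminus 0$ and $u\in T_{\pi(w)}M$ put $i_w(u)=\frac{d}{dt}\big|_{t=0}(w+tu)\in\mathscr{V}_wTM$; let $C(w)=i_w(w)$ be the canonical vector field and $\mathscr{J}(X)=i_w(d\pi(X))$, $X\in T_w(TM\setminus 0)$, the almost-tangent structure. Let $S$ be a spray on $M$, i.e. a smooth vector field on $TM\setminus 0$ with $\mathscr{J}(S)=C$ and $[C,S]=S$. Let $\Gamma_S=-[S,\mathscr{J}]$, i.e. $\Gamma_S(X)=-\bigl([S,\mathscr{J}X]-\mathscr{J}[S,X]\bigr)$, be its canonical connection, and let $\mathscr{H}=\frac12(\mathbf{I}+\Gamma_S)$ and $\mathscr{V}=\frac12(\mathbf{I}-\Gamma_S)$ be the projections onto the horizontal distribution $\mathscr{H}TM=\ker(\Gamma_S-\mathbf{I})$ and the vertical distribution $\mathscr{V}TM=\ker(\Gamma_S+\mathbf{I})$. A linear connection $\nabla$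 on $p:\mathscr{V}TM\to TM\setminus 0$ is called a lift of $\Gamma_S$ if $\nabla_XC=X$ for every vertical $X$ and the kernel of $X\mapsto\nabla_XC$ is $\mathscr{H}TM$. Its torsion is ${\rm T}(X,Y)=\nabla_X\mathscr{J}(Y)-\nabla_Y\mathscr{J}(X)-\mathscr{J}[X,Y]$. A $\mathscr{V}TM$-valued tensor field $\mathscr{C}$ (bilinear in $X,Y$) on $TM\setminus 0$ is called semi-basic if $\mathscr{C}(X,Y)=0$ whenever at least one of $X,Y$ is vertical. Then: 1. There is a unique $(1,1)$-tensor field $\mathscr{F}$ on $TM\setminus 0$ with $\mathscr{F}\mathscr{J}=\mathscr{H}$ and $\mathscr{F}\mathscr{H}=-\mathscr{J}$. 2. There is a unique linear connection $\nabla^*$ on $\mathscr{V}TM$ (the Berwald connection of $S$) with $$\nabla^*_{\mathscr{J}X}\mathscr{J}Y=\mathscr{J}[\mathscr{J}X,Y],\qquad \nabla^*_{\mathscr{H}X}\mathscr{J}Y=\mathscr{V}[\mathscr{H}X,\mathscr{J}Y]$$ for all vector fields $X,Y$ on $TM\setminus 0$, and $\nabla^*$ is a lift of $\Gamma_S$.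 3. There is a bijection $\nabla\leftrightarrow(\mathscr{C},\mathscr{C}')$ between the lifts $\nabla$ of $\Gamma_S$ and the pairs $(\mathscr{C},\mathscr{C}')$ of semi-basic $\mathscr{V}TM$-valued tensor fields on $TM\setminus 0$ satisfying $\mathscr{C}(\cdot,S)=\mathscr{C}'(\cdot,S)=0$, such that for all corresponding $\nabla$ and $(\mathscr{C},\mathscr{C}')$ and all vector fields $X,Y$ on $TM\setminus 0$ $$\nabla_X\mathscr{J}(Y)=\nabla^*_X\mathscr{J}(Y)+\mathscr{C}(\mathscr{F}X,Y)+\mathscr{C}'(X,Y),$$ $$\mathscr{C}(X,Y)={\rm T}(\mathscr{J}X,Y),\qquad \mathscr{C}'(X,Y)=\nabla_{\mathscr{H}X}\mathscr{J}(Y)-\mathscr{V}[\mathscr{H}X,\mathscr{J}(Y)].$$ -/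

import Mathlib

open scoped Manifold ContDiff Topology
open Bundle
noncomputable section
namespace SprayGeometry
section Defs
variable (E : Type*) [NormedAddCommGroup E] [NormedSpace ℝ E]
  (M : Type*) [TopologicalSpace M] [ChartedSpace E M] [IsManifold 𝓘(ℝ, E) ∞ M]

theorem isOpen_nonzero :
    IsOpen {w : TangentBundle 𝓘(ℝ, E) M | w.snd ≠ 0} := by
  rw [isOpen_iff_mem_nhds]
  intro w hw
  set e := trivializationAt E (TangentSpace 𝓘(ℝ, E)) w.proj with he
  have hw' : w ∈ e.source := FiberBundle.mem_trivializationAt_proj_source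
  have key : ∀ v ∈ e.source, ((e v).2 ≠ 0 ↔ v.snd ≠ 0) := by
    intro v hv
    have hb : v.proj ∈ e.baseSet := e.mem_source.1 hv
    have h1 : (e v).2 = e.continuousLinearEquivAt ℝ v.proj hb v.snd := by
      rw [Trivialization.continuousLinearEquivAt_apply]
    rw [h1]; exact (map_ne_zero_iff _ (ContinuousLinearEquiv.injective _))
  have h3 : ∀ᶠ v in 𝓝 w, (e v).2 ≠ 0 :=
    (continuous_snd.continuousAt.comp (e.continuousAt hw')).eventually_ne
      (by exact (key w hw').2 hw)
  filter_upwards [h3, e.open_source.mem_nhds hw'] with v hv hvs using (key v hvs).1 hv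

/-- `TM ∖ 0`, the tangent bundle without the null section, as an open submanifold of `TM`. -/
abbrev SlitTangentBundle : TopologicalSpace.Opens (TangentBundle 𝓘(ℝ, E) M) :=
  ⟨{w | w.snd ≠ 0}, isOpen_nonzero E M⟩

/-- Smooth real functions on `TM ∖ 0`. -/
abbrev SmoothFun := C^∞⟮𝓘(ℝ, E).tangent, SlitTangentBundle E M; 𝓘(ℝ, ℝ), ℝ⟯

/-- Smooth vector fields on `TM ∖ 0`. -/
abbrev VectorField :=
  Cₛ^∞⟮𝓘(ℝ, E).tangent; E × E, (TangentSpace 𝓘(ℝ, E).tangent : SlitTangentBundle E M → Type _)⟯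

variable {E M}

instance instSMulVectorField : SMul (SmoothFun E M) (VectorField E M) :=
  ⟨fun f X => ⟨fun w => f w • X w, f.contMDiff.smul_section X.contMDiff⟩⟩

theorem smul_apply (f : SmoothFun E M) (X : VectorField E M) (w : SlitTangentBundle E M) :
    (f • X) w = f w • X w := rfl

instance instModuleVectorField : Module (SmoothFun E M) (VectorField E M) where
  one_smul X := by ext w; exact one_smul _ _
  mul_smul f g X := by ext w; exact mul_smul _ _ _
  smul_zero f := by ext w; exact smul_zero _
  smul_add f X Y := by ext w; exact smul_add _ _ _
  add_smul f g X := by ext w; exact add_smul _ _ _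
  zero_smul X := by ext w; exact zero_smul _ _

/-- The footpoint projection `π : TM ∖ 0 → M`. -/
def proj (w : SlitTangentBundle E M) : M := w.1.proj

/-- The differential `dπ(w) : T_w(TM ∖ 0) → T_{π(w)}M`. -/
def dproj (w : SlitTangentBundle E M) :
    TangentSpace 𝓘(ℝ, E).tangent w →L[ℝ] TangentSpace 𝓘(ℝ, E) w.1.proj :=
  mfderiv 𝓘(ℝ, E).tangent 𝓘(ℝ, E) (proj : SlitTangentBundle E M → M) w

/-- The curve `t ↦ w + t u` in `TM ∖ 0`. At those `t` (never near `0`) where `w + t u` vanishes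
the value is set to `w`. -/
def moveInFiber (w : SlitTangentBundle E M) (u : TangentSpace 𝓘(ℝ, E) w.1.proj) (t : ℝ) :
    SlitTangentBundle E M :=
  open Classical in
  if h : w.1.snd + t • u ≠ 0 then ⟨⟨w.1.proj, w.1.snd + t • u⟩, h⟩ else w

/-- The vertical lift `i_w(u) = (d/dt)|_{t=0} (w + t u)`. -/
def verticalLift (w : SlitTangentBundle E M) (u : TangentSpace 𝓘(ℝ, E) w.1.proj) :
    TangentSpace 𝓘(ℝ, E).tangent w :=
  mfderiv 𝓘(ℝ, ℝ) 𝓘(ℝ, E).tangent (moveInFiber w u) 0 (1 : ℝ)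

theorem moveInFiber_zero (w : SlitTangentBundle E M) (u : TangentSpace 𝓘(ℝ, E) w.1.proj) :
    moveInFiber w u 0 = w := by
  unfold moveInFiber
  split_ifs with h
  · apply Subtype.ext
    change (⟨w.1.proj, w.1.snd + (0 : ℝ) • u⟩ : TangentBundle 𝓘(ℝ, E) M) = w.1
    rw [zero_smul, add_zero]
  · rfl

theorem proj_moveInFiber (w : SlitTangentBundle E M) (u : TangentSpace 𝓘(ℝ, E) w.1.proj) (t : ℝ) :
    (moveInFiber w u t).1.proj = w.1.proj := by
  unfold moveInFiber
  split_ifs <;> rfl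

theorem contMDiffAt_moveInFiber (u : ∀ w : SlitTangentBundle E M, TangentSpace 𝓘(ℝ, E) w.1.proj)
    (hu : ContMDiff 𝓘(ℝ, E).tangent 𝓘(ℝ, E).tangent ∞
      (fun w : SlitTangentBundle E M => (⟨w.1.proj, u w⟩ : TangentBundle 𝓘(ℝ, E) M)))
    (w₀ : SlitTangentBundle E M) :
    ContMDiffAt (𝓘(ℝ, E).tangent.prod 𝓘(ℝ, ℝ)) 𝓘(ℝ, E).tangent ∞
      (Function.uncurry fun (w : SlitTangentBundle E M) (t : ℝ) => moveInFiber w (u w) t)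
      (w₀, 0) := by
  rw [← ContMDiffAt.subtypeVal_comp_iff]
  have hval : ContMDiff 𝓘(ℝ, E).tangent 𝓘(ℝ, E).tangent ∞
      (Subtype.val : SlitTangentBundle E M → TangentBundle 𝓘(ℝ, E) M) := contMDiff_subtype_val
  have hval' : ContMDiffAt (𝓘(ℝ, E).tangent.prod 𝓘(ℝ, ℝ)) 𝓘(ℝ, E).tangent ∞
      (fun p : SlitTangentBundle E M × ℝ => (p.1.1 : TangentBundle 𝓘(ℝ, E) M)) (w₀, 0) :=
    (hval.comp contMDiff_fst).contMDiffAt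
  have hu' : ContMDiffAt (𝓘(ℝ, E).tangent.prod 𝓘(ℝ, ℝ)) 𝓘(ℝ, E).tangent ∞
      (fun p : SlitTangentBundle E M × ℝ =>
        (⟨p.1.1.proj, u p.1⟩ : TangentBundle 𝓘(ℝ, E) M)) (w₀, 0) :=
    (hu.comp contMDiff_fst).contMDiffAt
  set e := trivializationAt E (TangentSpace 𝓘(ℝ, E)) w₀.1.proj with he
  have key : ContMDiffAt (𝓘(ℝ, E).tangent.prod 𝓘(ℝ, ℝ)) 𝓘(ℝ, E).tangent ∞
      (fun p : SlitTangentBundle E M × ℝ =>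
        (⟨p.1.1.proj, p.1.1.snd + p.2 • u p.1⟩ : TangentBundle 𝓘(ℝ, E) M)) (w₀, 0) := by
    rw [contMDiffAt_totalSpace] at hval' hu' ⊢
    refine ⟨hval'.1, ?_⟩
    have ht : ContMDiffAt (𝓘(ℝ, E).tangent.prod 𝓘(ℝ, ℝ)) 𝓘(ℝ, ℝ) ∞
      (fun p : SlitTangentBundle E M × ℝ => p.2) (w₀, 0) := contMDiffAt_snd
    refine (hval'.2.add (ht.smul hu'.2)).congr_of_eventuallyEq ?_
    have hb : ∀ᶠ p : SlitTangentBundle E M × ℝ in 𝓝 (w₀, 0), p.1.1.proj ∈ e.baseSet :=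
      hval'.1.continuousAt (e.open_baseSet.mem_nhds (FiberBundle.mem_baseSet_trivializationAt' _))
    filter_upwards [hb] with p hp
    have hl := e.linear ℝ hp
    exact (hl.map_add _ _).trans (congrArg _ (hl.map_smul _ _))
  have hopen : ∀ᶠ p : SlitTangentBundle E M × ℝ in 𝓝 (w₀, 0), p.1.1.snd + p.2 • u p.1 ≠ 0 := by
    refine key.continuousAt ((isOpen_nonzero E M).mem_nhds ?_)
    change w₀.1.snd + (0 : ℝ) • u w₀ ≠ 0
    rw [zero_smul, add_zero]
    exact w₀.2
  refine key.congr_of_eventuallyEq ?_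
  filter_upwards [hopen] with p hp
  simp only [Function.comp, Function.uncurry, moveInFiber, dif_pos hp]

theorem contMDiff_verticalLift (u : ∀ w : SlitTangentBundle E M, TangentSpace 𝓘(ℝ, E) w.1.proj)
    (hu : ContMDiff 𝓘(ℝ, E).tangent 𝓘(ℝ, E).tangent ∞
      (fun w : SlitTangentBundle E M => (⟨w.1.proj, u w⟩ : TangentBundle 𝓘(ℝ, E) M))) :
    ContMDiff 𝓘(ℝ, E).tangent 𝓘(ℝ, E).tangent.tangent ∞
      (fun w => (⟨w, verticalLift w (u w)⟩ :
        TangentBundle 𝓘(ℝ, E).tangent (SlitTangentBundle E M))) := by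
  intro w₀
  rw [contMDiffAt_section]
  have h := ContMDiffAt.mfderiv_apply (m := ∞) (n := ∞) (I := 𝓘(ℝ, ℝ)) (I' := 𝓘(ℝ, E).tangent)
    (x₀ := w₀) (fun (w : SlitTangentBundle E M) (t : ℝ) => moveInFiber w (u w) t)
    (fun _ => (0 : ℝ)) (fun w => w) (fun _ => (1 : ℝ)) (contMDiffAt_moveInFiber u hu w₀)
    contMDiffAt_const contMDiffAt_id contMDiffAt_const (by simp)
  refine h.congr_of_eventuallyEq ?_
  have hg : (fun w => moveInFiber w (u w) 0) = fun w : SlitTangentBundle E M => w :=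
    funext fun w => moveInFiber_zero w (u w)
  rw [hg]
  set e := trivializationAt (E × E) (TangentSpace 𝓘(ℝ, E).tangent) w₀ with he
  filter_upwards [e.open_baseSet.mem_nhds (FiberBundle.mem_baseSet_trivializationAt' w₀)] with w hw
  simp only [inTangentCoordinates, ContinuousLinearMap.inCoordinates,
    ContinuousLinearMap.comp_apply, TangentBundle.symmL_model_space]
  exact (Trivialization.continuousLinearMapAt_apply_of_mem ℝ e hw _).symm

theorem contMDiff_proj :
    ContMDiff 𝓘(ℝ, E).tangent 𝓘(ℝ, E) ∞ (proj : SlitTangentBundle E M → M) :=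
  (Bundle.contMDiff_proj (TangentSpace 𝓘(ℝ, E) : M → Type _)).comp contMDiff_subtype_val

theorem dproj_verticalLift (w : SlitTangentBundle E M) (u : TangentSpace 𝓘(ℝ, E) w.1.proj) :
    dproj w (verticalLift w u) = 0 := by
  by_cases hd : MDifferentiableAt 𝓘(ℝ, ℝ) 𝓘(ℝ, E).tangent (moveInFiber w u) 0
  · have hp : MDifferentiableAt 𝓘(ℝ, E).tangent 𝓘(ℝ, E)
        (proj : SlitTangentBundle E M → M) (moveInFiber w u 0) :=
      (contMDiff_proj (moveInFiber w u 0)).mdifferentiableAt (by simp)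
    have h := mfderiv_comp (0 : ℝ) hp hd
    have hc : (proj ∘ moveInFiber w u : ℝ → M) = fun _ => w.1.proj :=
      funext fun t => proj_moveInFiber w u t
    rw [hc, mfderiv_const, moveInFiber_zero] at h
    exact (DFunLike.congr_fun h (1 : ℝ)).symm
  · unfold verticalLift
    rw [mfderiv_zero_of_not_mdifferentiableAt hd]
    exact map_zero (dproj w)

variable (E M) in
/-- Vertical vector fields, i.e. smooth sections of `𝒱TM = ker dπ → TM ∖ 0`, as a module over the
smooth functions on `TM ∖ 0`. -/
def VerticalField : Submodule (SmoothFun E M) (VectorField E M) where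
  carrier := {X | ∀ w, dproj w (X w) = 0}
  zero_mem' w := map_zero (dproj w)
  add_mem' {X Y} hX hY w := by
    refine (map_add (dproj w) (X w) (Y w)).trans ?_
    rw [hX w, hY w, add_zero]
  smul_mem' f X hX w := by
    refine (map_smul (dproj w) (f w) (X w)).trans ?_
    rw [hX w, smul_zero]

/-- The canonical (vertical) vector field `C(w) = i_w(w)`. -/
def canonicalField : VerticalField E M :=
  ⟨⟨fun w => verticalLift w w.1.snd, contMDiff_verticalLift _ contMDiff_subtype_val⟩,
    fun w => dproj_verticalLift w _⟩

/-- The almost-tangent structure `𝒥(X)(w) = i_w(dπ(X_w))`, acting on vector fields. -/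
def almostTangent (X : VectorField E M) : VerticalField E M :=
  ⟨⟨fun w => verticalLift w (dproj w (X w)), contMDiff_verticalLift _
      ((contMDiff_proj.contMDiff_tangentMap (m := ∞) (by simp)).comp X.contMDiff)⟩,
    fun w => dproj_verticalLift w _⟩

variable [FiniteDimensional ℝ E]

/-- The Lie bracket of vector fields on `TM ∖ 0`. -/
def lieBracket (X Y : VectorField E M) : VectorField E M :=
  ⟨VectorField.mlieBracket 𝓘(ℝ, E).tangent X Y, by
    have : CompleteSpace E := FiniteDimensional.complete ℝ E
    have : IsManifold 𝓘(ℝ, E).tangent (((⊤ : ℕ∞) : ℕ∞ω) + 1) (SlitTangentBundle E M) :=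
      inferInstanceAs (IsManifold 𝓘(ℝ, E).tangent ∞ (SlitTangentBundle E M))
    have : IsManifold 𝓘(ℝ, E).tangent (minSmoothness ℝ 2) (SlitTangentBundle E M) := by
      rw [minSmoothness_of_isRCLikeNormedField]
      infer_instance
    exact ContDiff.mlieBracket_vectorField (m := ⊤) (n := ⊤) X.contMDiff Y.contMDiff (by simp)⟩

/-- `S` is a spray: a second order differential equation (`𝒥(S) = C`) with `[C, S] = S`. -/
structure IsSpray (S : VectorField E M) : Prop where
  almostTangent_eq : almostTangent S = canonicalField
  homogeneous : lieBracket (canonicalField : VerticalField E M) S = S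

/-- The canonical connection `Γ_S = -[S, 𝒥]`, minus the Lie derivative of `𝒥` along `S`:
`Γ_S(X) = -([S, 𝒥 X] - 𝒥 [S, X])`. -/
def canonicalConnection (S X : VectorField E M) : VectorField E M :=
  -(lieBracket S (almostTangent X) - almostTangent (lieBracket S X))

/-- The projection `ℋ` onto `ℋTM = ker(Γ_S - I)`. -/
def horizontalPart (S X : VectorField E M) : VectorField E M :=
  (1 / 2 : ℝ) • (X + canonicalConnection S X)

/-- The projection `𝒱` onto `𝒱TM = ker(Γ_S + I)`. -/
def verticalPart (S X : VectorField E M) : VectorField E M :=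
  (1 / 2 : ℝ) • (X - canonicalConnection S X)

/-- The derivative `(X f)(w) = df(w)(X_w)`. -/
def derivAlong (X : VectorField E M) (f : SmoothFun E M) (w : SlitTangentBundle E M) : ℝ :=
  mfderiv 𝓘(ℝ, E).tangent 𝓘(ℝ, ℝ) f w (X w)

variable (E M) in
/-- Linear connections on the vector bundle `𝒱TM → TM ∖ 0`. -/
@[ext]
structure LinearConnection where
  /-- `∇_X V` -/
  toFun : VectorField E M → VerticalField E M → VerticalField E M
  add_left : ∀ X Y V, toFun (X + Y) V = toFun X V + toFun Y V
  smul_left : ∀ (f : SmoothFun E M) X V, toFun (f • X) V = f • toFun X V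
  add_right : ∀ X V W, toFun X (V + W) = toFun X V + toFun X W
  leibniz : ∀ (f : SmoothFun E M) X V (w : SlitTangentBundle E M),
    (toFun X (f • V)).1 w =
      f w • (toFun X V).1 w + derivAlong X f w • V.1 w

instance instCoeFunLinearConnection : CoeFun (LinearConnection E M)
    (fun _ => VectorField E M → VerticalField E M → VerticalField E M) :=
  ⟨LinearConnection.toFun⟩

/-- `∇` is a lift of `Γ_S`: it is almost-projectable (`∇_X C = X` for `X` vertical) and the kernel
of `X ↦ ∇_X C` is the horizontal distribution `ker(Γ_S - I)`. -/
structure IsLift (S : VectorField E M) (D : LinearConnection E M) : Prop where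
  almostProjectable : ∀ X : VerticalField E M, D X canonicalField = X
  ker_eq : ∀ X : VectorField E M, D X canonicalField = 0 ↔ canonicalConnection S X = X

/-- The torsion `T(X, Y) = ∇_X 𝒥(Y) - ∇_Y 𝒥(X) - 𝒥[X, Y]`. -/
def LinearConnection.torsion (D : LinearConnection E M) (X Y : VectorField E M) :
    VerticalField E M :=
  D X (almostTangent Y) - D Y (almostTangent X) - almostTangent (lieBracket X Y)

/-- `D` is given by the formulas that define the Berwald connection of `S`:
`∇*_{𝒥X} 𝒥Y = 𝒥[𝒥X, Y]` and `∇*_{ℋX} 𝒥Y = 𝒱[ℋX, 𝒥Y]`. -/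
structure IsBerwald (S : VectorField E M) (D : LinearConnection E M) : Prop where
  vertical : ∀ X Y : VectorField E M,
    D (almostTangent X) (almostTangent Y) = almostTangent (lieBracket (almostTangent X) Y)
  horizontal : ∀ X Y : VectorField E M,
    (D (horizontalPart S X) (almostTangent Y) : VectorField E M) =
      verticalPart S (lieBracket (horizontalPart S X) (almostTangent Y))

/-- `F` is the almost-complex structure characterized by `ℱ𝒥 = ℋ` and `ℱℋ = -𝒥`; as a tensor
field of type `(1, 1)` it is a linear map over the smooth functions. -/
structure IsAlmostComplexStructure (S : VectorField E M)
    (F : VectorField E M →ₗ[SmoothFun E M] VectorField E M) : Prop where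
  comp_almostTangent : ∀ X : VectorField E M, F (almostTangent X) = horizontalPart S X
  comp_horizontal : ∀ X : VectorField E M, F (horizontalPart S X) = -almostTangent X

variable (E M) in
/-- `𝒱TM`-valued (smooth, twice covariant) tensor fields on `TM ∖ 0`: bilinear maps over the
smooth functions. -/
abbrev VerticalTensor :=
  VectorField E M →ₗ[SmoothFun E M] VectorField E M →ₗ[SmoothFun E M] VerticalField E M

/-- `T(X, Y) = 0` whenever at least one of `X, Y` is vertical. -/
def IsSemibasic (T : VerticalTensor E M) : Prop :=
  ∀ X Y : VectorField E M, X ∈ VerticalField E M ∨ Y ∈ VerticalField E M → T X Y = 0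

/-- The lifts of `Γ_S`. -/
abbrev Lift (S : VectorField E M) := {D : LinearConnection E M // IsLift S D}

/-- Pairs `(𝒞, 𝒞')` of semi-basic `𝒱TM`-valued tensor fields with
`𝒞(·, S) = 𝒞'(·, S) = 0`. -/
abbrev SemibasicPair (S : VectorField E M) :=
  {p : VerticalTensor E M × VerticalTensor E M //
    IsSemibasic p.1 ∧ IsSemibasic p.2 ∧ (∀ X, p.1 X S = 0) ∧ ∀ X, p.2 X S = 0}

end Defs
end SprayGeometry
end

/-! In bundle coordinates (x, y) on `TM ∖ 0`, `𝒥` moves the x-component of a field into the y-slot,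
and `𝒥S = C` says that the x-component of `S` is y. Hence, for vertical `V`, the x-component of `[V,
S]` is the derivative of y along `V`, which is the y-component of `V`: `V ↦ [V, S]` is a right
inverse of `𝒥` on vertical fields (`almostTangent_lie_of_semispray`). After this and `[C, 𝒥] = -𝒥`
(`lie_canonicalField_almostTangent`), also checked in coordinates, the argument is algebra over the
smooth functions in the Lie ring of vector fields.

The right inverse gives `Γ_S = -I` on vertical fields and `𝒥Γ_S = 𝒥`, so `ℋ` and `𝒱` are
complementary projections. It also yields closed formulas for the two canonical objects, `ℱX = ℋ[𝒱X,
S] - 𝒥X` and `∇*_X V = 𝒥[𝒱X, [V, S]] + 𝒱[ℋX, V]`. Uniqueness follows because every field is some `ℋX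
+ 𝒥Z` and every vertical field is some `𝒥Y`.

Homogeneity `[C, S] = S` together with `[C, 𝒥] = -𝒥` makes `[C, ·]` commute with `Γ_S`, so `𝒱[ℋX, C]
= 0` and `∇*_X C = 𝒱X`. A connection is a lift exactly when `∇_X C = 𝒱X` (`isLift_iff`). Lifts are
therefore `∇*` plus tensors `T` with `T(·, C) = 0`. Such a `T` is determined by `𝒞(X, Y) = T(𝒥X,
𝒥Y)` and `𝒞'(X, Y) = T(ℋX, 𝒥Y)`, and since `C = 𝒥S` the condition on `T` is the vanishing of both at
`Y = S`. -/

/-! ### Differentials of vector-valued functions. -/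

theorem mvfderiv_comp_mfderiv_apply {E E' F : Type*} [NormedAddCommGroup E] [NormedSpace ℝ E]
    [NormedAddCommGroup E'] [NormedSpace ℝ E'] [NormedAddCommGroup F] [NormedSpace ℝ F]
    {H H' : Type*} [TopologicalSpace H] [TopologicalSpace H']
    {I : ModelWithCorners ℝ E H} {I' : ModelWithCorners ℝ E' H'}
    {N N' : Type*} [TopologicalSpace N] [ChartedSpace H N] [TopologicalSpace N']
    [ChartedSpace H' N'] {g : N' → F} {f : N → N'} {x : N}
    (hg : MDifferentiableAt I' 𝓘(ℝ, F) g (f x)) (hf : MDifferentiableAt I I' f x)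
    (v : TangentSpace I x) :
    mvfderiv I (g ∘ f) x v = mvfderiv I' g (f x) (mfderiv I I' f x v) :=
  mfderiv_comp_apply x hg hf v

theorem Filter.EventuallyEq.mvfderiv_eq {E F : Type*} [NormedAddCommGroup E] [NormedSpace ℝ E]
    [NormedAddCommGroup F] [NormedSpace ℝ F]
    {H : Type*} [TopologicalSpace H] {I : ModelWithCorners ℝ E H}
    {N : Type*} [TopologicalSpace N] [ChartedSpace H N] {f g : N → F} {x : N}
    (h : f =ᶠ[𝓝 x] g) : mvfderiv I f x = mvfderiv I g x := by
  have h' : mfderiv I 𝓘(ℝ, F) f x = (mfderiv I 𝓘(ℝ, F) g x :) := h.mfderiv_eq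
  ext v
  exact congrArg (fun L : TangentSpace I x →L[ℝ] F => L v) h'

theorem mvfderiv_modelSpace_apply {E F : Type*} [NormedAddCommGroup E] [NormedSpace ℝ E]
    [NormedAddCommGroup F] [NormedSpace ℝ F] (f : E → F) (x v : E) :
    mvfderiv 𝓘(ℝ, E) f x v = fderiv ℝ f x v :=
  DFunLike.congr_fun (mfderiv_eq_fderiv (f := f) (x := x)) v

theorem ContinuousLinearMap.mvfderiv_comp_apply {E F F' : Type*}
    [NormedAddCommGroup E] [NormedSpace ℝ E] [NormedAddCommGroup F] [NormedSpace ℝ F]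
    [NormedAddCommGroup F'] [NormedSpace ℝ F']
    {H : Type*} [TopologicalSpace H] {I : ModelWithCorners ℝ E H}
    {N : Type*} [TopologicalSpace N] [ChartedSpace H N] (L : F →L[ℝ] F') {g : N → F} {x : N}
    (hg : MDifferentiableAt I 𝓘(ℝ, F) g x) (v : TangentSpace I x) :
    mvfderiv I (L ∘ g) x v = L (mvfderiv I g x v) := by
  have h : mfderiv 𝓘(ℝ, F) 𝓘(ℝ, F') L (g x) = L := L.mfderiv_eq
  exact (mvfderiv_comp_mfderiv_apply (I' := 𝓘(ℝ, F)) (g := L) L.mdifferentiableAt hg v).trans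
    (DFunLike.congr_fun h (mvfderiv I g x v))

/-! ### The Lie bracket in a chart. -/

namespace VectorField

section Chart

variable {E : Type*} [NormedAddCommGroup E] [NormedSpace ℝ E]
  {H : Type*} [TopologicalSpace H] {I : ModelWithCorners ℝ E H}
  {N : Type*} [TopologicalSpace N] [ChartedSpace H N]

/-- The coordinate representation of a vector field in the chart at `x₀`. -/
noncomputable def chartRep (I : ModelWithCorners ℝ E H) (x₀ : N) (U : Π x : N, TangentSpace I x) :
    E → E := fun y =>
  NormedSpace.fromTangentSpace y
    (mpullbackWithin 𝓘(ℝ, E) I (extChartAt I x₀).symm U (Set.range I) y)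

/-- Pulling back along the inverse chart applies the inverse of its differential, which is the
differential of the chart. -/
theorem chartRep_extChartAt [IsManifold I 1 N] {x₀ : N} (U : Π x : N, TangentSpace I x) {x : N}
    (hx : x ∈ (extChartAt I x₀).source) :
    chartRep I x₀ U (extChartAt I x₀ x) = mvfderiv I (extChartAt I x₀) x (U x) := by
  have h : mpullbackWithin 𝓘(ℝ, E) I (extChartAt I x₀).symm U (Set.range I) (extChartAt I x₀ x)
      = mfderiv I 𝓘(ℝ, E) (extChartAt I x₀) x (U x) := by
    rw [mpullbackWithin_apply, (extChartAt I x₀).left_inv hx]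
    refine DFunLike.congr_fun (ContinuousLinearMap.inverse_eq ?_ ?_) _
    · exact mfderivWithin_extChartAt_symm_comp_mfderiv_extChartAt' hx
    · exact mfderiv_extChartAt_comp_mfderivWithin_extChartAt_symm' hx
  exact h

theorem eventuallyEq_chartRep [IsManifold I 1 N] {x₀ : N} (U : Π x : N, TangentSpace I x) :
    (fun x => mvfderiv I (extChartAt I x₀) x (U x)) =ᶠ[𝓝 x₀]
      chartRep I x₀ U ∘ extChartAt I x₀ := by
  filter_upwards [extChartAt_source_mem_nhds (I := I) x₀] with x hx
  exact (chartRep_extChartAt U hx).symm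

variable [I.Boundaryless] [CompleteSpace E] [IsManifold I 2 N]

theorem differentiableAt_chartRep {U : Π x : N, TangentSpace I x} {x₀ : N}
    (hU : MDifferentiableAt I I.tangent (fun x => (⟨x, U x⟩ : TangentBundle I N)) x₀) :
    DifferentiableAt ℝ (chartRep I x₀ U) (extChartAt I x₀ x₀) := by
  have h : DifferentiableWithinAt ℝ (chartRep I x₀ U)
      ((extChartAt I x₀).symm ⁻¹' Set.univ ∩ Set.range I) (extChartAt I x₀ x₀) :=
    (mdifferentiableWithinAt_univ.2 hU).differentiableWithinAt_mpullbackWithin_vectorField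
  rwa [I.range_eq_univ, Set.preimage_univ, Set.univ_inter, differentiableWithinAt_univ] at h

theorem mdifferentiableAt_mvfderiv_extChartAt {U : Π x : N, TangentSpace I x} {x₀ : N}
    (hU : MDifferentiableAt I I.tangent (fun x => (⟨x, U x⟩ : TangentBundle I N)) x₀) :
    MDifferentiableAt I 𝓘(ℝ, E) (fun x => mvfderiv I (extChartAt I x₀) x (U x)) x₀ := by
  have : IsManifold I 1 N := IsManifold.of_le (n := 2) one_le_two
  exact ((differentiableAt_chartRep hU).mdifferentiableAt.comp x₀
    (mdifferentiableAt_extChartAt (I := I) (mem_chart_source H x₀))).congr_of_eventuallyEq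
    (eventuallyEq_chartRep U)

/-- In a chart, the Lie bracket is the difference of the directional derivatives of the coordinate
representations of the two vector fields. -/
theorem mvfderiv_extChartAt_mlieBracket {V W : Π x : N, TangentSpace I x} {x₀ : N}
    (hV : MDifferentiableAt I I.tangent (fun x => (⟨x, V x⟩ : TangentBundle I N)) x₀)
    (hW : MDifferentiableAt I I.tangent (fun x => (⟨x, W x⟩ : TangentBundle I N)) x₀) :
    mvfderiv I (extChartAt I x₀) x₀ (mlieBracket I V W x₀) =
      mvfderiv I (fun x => mvfderiv I (extChartAt I x₀) x (W x)) x₀ (V x₀) -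
        mvfderiv I (fun x => mvfderiv I (extChartAt I x₀) x (V x)) x₀ (W x₀) := by
  have : IsManifold I 1 N := IsManifold.of_le (n := 2) one_le_two
  have der : ∀ (U V : Π x : N, TangentSpace I x),
      MDifferentiableAt I I.tangent (fun x => (⟨x, U x⟩ : TangentBundle I N)) x₀ →
      mvfderiv I (fun x => mvfderiv I (extChartAt I x₀) x (U x)) x₀ (V x₀) =
      fderiv ℝ (chartRep I x₀ U) (extChartAt I x₀ x₀)
        (mvfderiv I (extChartAt I x₀) x₀ (V x₀)) := by
    intro U V hU
    have h1 := mvfderiv_comp_mfderiv_apply (I := I) (x := x₀)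
      (differentiableAt_chartRep hU).mdifferentiableAt
      (mdifferentiableAt_extChartAt (I := I) (mem_chart_source H x₀)) (V x₀)
    exact (DFunLike.congr_fun (eventuallyEq_chartRep U).mvfderiv_eq (V x₀)).trans
      (h1.trans (mvfderiv_modelSpace_apply _ _ _))
  rw [der W V hW, der V W hV, ← chartRep_extChartAt V (mem_extChartAt_source x₀),
    ← chartRep_extChartAt W (mem_extChartAt_source x₀)]
  -- The bracket is by definition the flat bracket of the coordinate representations, pulled back by
  -- the chart; without boundary, the within-set is the whole space.
  have hb : mlieBracket I V W x₀ = (mfderiv I 𝓘(ℝ, E) (extChartAt I x₀) x₀).inverse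
      ((NormedSpace.fromTangentSpace _).symm
        (lieBracket ℝ (chartRep I x₀ V) (chartRep I x₀ W) (extChartAt I x₀ x₀))) := by
    have h : lieBracket ℝ (chartRep I x₀ V) (chartRep I x₀ W) =
        lieBracketWithin ℝ (chartRep I x₀ V) (chartRep I x₀ W)
          ((extChartAt I x₀).symm ⁻¹' Set.univ ∩ Set.range I) := by
      rw [I.range_eq_univ, Set.preimage_univ, Set.univ_inter, lieBracketWithin_univ]
    rw [h]
    rfl
  rw [hb]
  exact DFunLike.congr_fun (isInvertible_mfderiv_extChartAt
    (mem_extChartAt_source (I := I) x₀)).self_comp_inverse _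

end Chart

end VectorField

noncomputable section
namespace SprayGeometry
-- Bundle coordinates on the slit tangent bundle.
section Coordinates

variable {E : Type*} [NormedAddCommGroup E] [NormedSpace ℝ E]
  {M : Type*} [TopologicalSpace M] [ChartedSpace E M] [IsManifold 𝓘(ℝ, E) ∞ M]

/-- The coordinates of the footpoint in the chart at `w₀`. -/
def baseCoord (w₀ w : SlitTangentBundle E M) : E := extChartAt 𝓘(ℝ, E) w₀.1.proj w.1.proj

/-- The fibre coordinates in the chart at `w₀`. -/
def fiberCoord (w₀ w : SlitTangentBundle E M) : E :=
  (trivializationAt E (TangentSpace 𝓘(ℝ, E)) w₀.1.proj w.1).2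

/-- The domain of the bundle chart at `w₀`. -/
def coordDomain (w₀ : SlitTangentBundle E M) : Set (SlitTangentBundle E M) :=
  {w | w.1.proj ∈ (chartAt E w₀.1.proj).source}

variable {w₀ w : SlitTangentBundle E M}

theorem extChartAt_slitTangentBundle (w₀ w : SlitTangentBundle E M) :
    extChartAt 𝓘(ℝ, E).tangent w₀ w = (baseCoord w₀ w, fiberCoord w₀ w) := by
  exact congrArg (fun e => e w.1) (FiberBundle.extChartAt (IB := 𝓘(ℝ, E))
    (E := (TangentSpace 𝓘(ℝ, E) : M → Type _)) w₀.1)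

theorem chartAt_source_slitTangentBundle (w₀ : SlitTangentBundle E M) :
    (chartAt (ModelProd E E) w₀).source = coordDomain w₀ := by
  ext w
  have := TangentBundle.mem_chart_source_iff (I := 𝓘(ℝ, E)) w.1 w₀.1
  rw [coordDomain, Set.mem_ofPred_eq, ← this]
  simp [TopologicalSpace.Opens.chartAt_eq]

theorem coordDomain_mem_nhds (w : SlitTangentBundle E M) : coordDomain w ∈ 𝓝 w := by
  rw [← chartAt_source_slitTangentBundle]
  exact chart_source_mem_nhds _ w

theorem mvfderiv_extChartAt_slitTangentBundle_injective (hw : w ∈ coordDomain w₀) :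
    Function.Injective (mvfderiv 𝓘(ℝ, E).tangent (extChartAt 𝓘(ℝ, E).tangent w₀) w) := by
  have h : IsManifold 𝓘(ℝ, E).tangent 1 (SlitTangentBundle E M) := inferInstance
  have := isInvertible_mfderiv_extChartAt (I := 𝓘(ℝ, E).tangent) (x := w₀) (y := w) (by
    rw [extChartAt_source, chartAt_source_slitTangentBundle]; exact hw)
  exact this.injective

theorem contMDiffAt_extChartAt_slitTangentBundle (hw : w ∈ coordDomain w₀) :
    ContMDiffAt 𝓘(ℝ, E).tangent 𝓘(ℝ, E × E) ∞ (extChartAt 𝓘(ℝ, E).tangent w₀) w := by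
  refine contMDiffAt_extChartAt' ?_
  rw [chartAt_source_slitTangentBundle]; exact hw

theorem contMDiffAt_fiberCoord (hw : w ∈ coordDomain w₀) :
    ContMDiffAt 𝓘(ℝ, E).tangent 𝓘(ℝ, E) ∞ (fiberCoord w₀) w := by
  have := contDiff_snd.contMDiff.contMDiffAt.comp w (contMDiffAt_extChartAt_slitTangentBundle hw)
  refine this.congr_of_eventuallyEq (.of_forall fun w => ?_)
  exact (congrArg Prod.snd (extChartAt_slitTangentBundle w₀ w)).symm

theorem mdifferentiableAt_fiberCoord (hw : w ∈ coordDomain w₀) :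
    MDifferentiableAt 𝓘(ℝ, E).tangent 𝓘(ℝ, E) (fiberCoord w₀) w :=
  (contMDiffAt_fiberCoord hw).mdifferentiableAt (by simp)

variable (w₀) in
/-- The differential of the base coordinates. -/
def dBase (w : SlitTangentBundle E M) : TangentSpace 𝓘(ℝ, E).tangent w →L[ℝ] E :=
  mvfderiv 𝓘(ℝ, E).tangent (baseCoord w₀) w

variable (w₀) in
/-- The differential of the fibre coordinates. -/
def dFiber (w : SlitTangentBundle E M) : TangentSpace 𝓘(ℝ, E).tangent w →L[ℝ] E :=
  mvfderiv 𝓘(ℝ, E).tangent (fiberCoord w₀) w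

theorem mvfderiv_extChartAt_slitTangentBundle (hw : w ∈ coordDomain w₀)
    (ξ : TangentSpace 𝓘(ℝ, E).tangent w) :
    mvfderiv 𝓘(ℝ, E).tangent (extChartAt 𝓘(ℝ, E).tangent w₀) w ξ =
      (dBase w₀ w ξ, dFiber w₀ w ξ) := by
  have hd := (contMDiffAt_extChartAt_slitTangentBundle hw).mdifferentiableAt (by simp)
  have h₁ : baseCoord w₀ = ContinuousLinearMap.fst ℝ E E ∘ extChartAt 𝓘(ℝ, E).tangent w₀ :=
    funext fun w => (congrArg Prod.fst (extChartAt_slitTangentBundle w₀ w)).symm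
  have h₂ : fiberCoord w₀ = ContinuousLinearMap.snd ℝ E E ∘ extChartAt 𝓘(ℝ, E).tangent w₀ :=
    funext fun w => (congrArg Prod.snd (extChartAt_slitTangentBundle w₀ w)).symm
  rw [dBase, dFiber, h₁, h₂, ContinuousLinearMap.mvfderiv_comp_apply _ hd,
    ContinuousLinearMap.mvfderiv_comp_apply _ hd]
  rfl

theorem ext_coord (hw : w ∈ coordDomain w₀) {ξ η : TangentSpace 𝓘(ℝ, E).tangent w}
    (h₁ : dBase w₀ w ξ = dBase w₀ w η) (h₂ : dFiber w₀ w ξ = dFiber w₀ w η) : ξ = η := by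
  apply mvfderiv_extChartAt_slitTangentBundle_injective hw
  rw [mvfderiv_extChartAt_slitTangentBundle hw, mvfderiv_extChartAt_slitTangentBundle hw, h₁, h₂]

theorem dBase_eq (hw : w ∈ coordDomain w₀) (ξ : TangentSpace 𝓘(ℝ, E).tangent w) :
    dBase w₀ w ξ = mvfderiv 𝓘(ℝ, E) (extChartAt 𝓘(ℝ, E) w₀.1.proj) w.1.proj (dproj w ξ) :=
  have : IsManifold 𝓘(ℝ, E) 1 M := IsManifold.of_le (n := ∞) (by simp)
  mvfderiv_comp_mfderiv_apply (f := proj) (x := w) (mdifferentiableAt_extChartAt hw)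
    ((contMDiff_proj w).mdifferentiableAt (by simp)) ξ

theorem dBase_eq_zero_iff (hw : w ∈ coordDomain w₀) (ξ : TangentSpace 𝓘(ℝ, E).tangent w) :
    dBase w₀ w ξ = 0 ↔ dproj w ξ = 0 := by
  have : IsManifold 𝓘(ℝ, E) 1 M := IsManifold.of_le (n := ∞) (by simp)
  have hinj : Function.Injective
      (mvfderiv 𝓘(ℝ, E) (extChartAt 𝓘(ℝ, E) w₀.1.proj) w.1.proj) :=
    (isInvertible_mfderiv_extChartAt (I := 𝓘(ℝ, E)) (x := w₀.1.proj) (y := w.1.proj)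
      (by rw [extChartAt_source]; exact hw)).injective
  rw [dBase_eq hw, map_eq_zero_iff _ hinj]

/-- On each fibre, the trivialization of the tangent bundle is the differential of the base chart.
-/
theorem fiberCoord_eq (hw : w ∈ coordDomain w₀) :
    fiberCoord w₀ w =
      mvfderiv 𝓘(ℝ, E) (extChartAt 𝓘(ℝ, E) w₀.1.proj) w.1.proj w.1.snd := by
  have : IsManifold 𝓘(ℝ, E) 1 M := IsManifold.of_le (n := ∞) (by simp)
  have h := TangentBundle.continuousLinearMapAt_trivializationAt (I := 𝓘(ℝ, E)) hw
  refine Eq.trans ?_ (DFunLike.congr_fun h w.1.snd)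
  rw [Trivialization.continuousLinearMapAt_apply_of_mem ℝ _ (by exact hw)]
  rfl

/-- Fibre coordinates are linear on each fibre, so along `t ↦ w + t u` they are affine in `t`. A
smooth field `u` is taken, not a single vector, because the differentiability of the curve comes
from `contMDiffAt_moveInFiber`. -/
theorem dFiber_verticalLift (hw : w ∈ coordDomain w₀)
    (u : ∀ w : SlitTangentBundle E M, TangentSpace 𝓘(ℝ, E) w.1.proj)
    (hu : ContMDiff 𝓘(ℝ, E).tangent 𝓘(ℝ, E).tangent ∞
      (fun w : SlitTangentBundle E M => (⟨w.1.proj, u w⟩ : TangentBundle 𝓘(ℝ, E) M))) :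
    dFiber w₀ w (verticalLift w (u w)) =
      mvfderiv 𝓘(ℝ, E) (extChartAt 𝓘(ℝ, E) w₀.1.proj) w.1.proj (u w) := by
  set L := mvfderiv 𝓘(ℝ, E) (extChartAt 𝓘(ℝ, E) w₀.1.proj) w.1.proj with hL
  have hdiff : MDifferentiableAt 𝓘(ℝ, ℝ) 𝓘(ℝ, E).tangent (moveInFiber w (u w)) 0 := by
    have h1 := contMDiffAt_moveInFiber u hu w
    have h2 : ContMDiffAt 𝓘(ℝ, ℝ) (𝓘(ℝ, E).tangent.prod 𝓘(ℝ, ℝ)) ∞ (fun t : ℝ => (w, t)) 0 :=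
      contMDiffAt_const.prodMk contMDiffAt_id
    exact (ContMDiffAt.comp (0 : ℝ) h1 h2).mdifferentiableAt (by simp)
  have h0 : moveInFiber w (u w) 0 = w := moveInFiber_zero w (u w)
  have hcomp := mvfderiv_comp_mfderiv_apply (I := 𝓘(ℝ, ℝ)) (f := moveInFiber w (u w)) (x := 0)
    (g := fiberCoord w₀) (mdifferentiableAt_fiberCoord (h0.symm ▸ hw)) hdiff (1 : ℝ)
  -- The curve starts at `w` only up to a propositional equality; both tangent spaces are read as `E
  -- × E` to change the base point.
  have hbase : dFiber w₀ w (verticalLift w (u w)) =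
      mvfderiv 𝓘(ℝ, E).tangent (fiberCoord w₀) (moveInFiber w (u w) 0)
        (mfderiv 𝓘(ℝ, ℝ) 𝓘(ℝ, E).tangent (moveInFiber w (u w)) 0 (1 : ℝ)) :=
    congrArg (fun z => (mvfderiv 𝓘(ℝ, E).tangent (fiberCoord w₀) z : E × E →L[ℝ] E)
      (verticalLift w (u w))) h0.symm
  have hev : (fiberCoord w₀ ∘ moveInFiber w (u w)) =ᶠ[𝓝 0]
      fun t : ℝ => fiberCoord w₀ w + t • L (u w) := by
    have hne (v v' : E) (hv : v ≠ 0) : ∀ᶠ t : ℝ in 𝓝 0, v + t • v' ≠ 0 := by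
      have hc : Continuous fun t : ℝ => v + t • v' := by fun_prop
      exact hc.continuousAt.eventually_ne (by simpa using hv)
    -- For small `t` the vector `w + t u` is nonzero, so the curve does not take its default value.
    filter_upwards [hne w.1.snd (u w) w.2] with t ht
    have hm : moveInFiber w (u w) t = ⟨⟨w.1.proj, w.1.snd + t • u w⟩, ht⟩ := dif_pos ht
    rw [Function.comp_apply, hm, fiberCoord_eq (by exact hw), fiberCoord_eq hw, ← hL]
    exact (map_add L _ _).trans (congrArg _ (map_smul L _ _))
  have hd : HasDerivAt (fun t : ℝ => fiberCoord w₀ w + t • L (u w)) (L (u w)) 0 := by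
    simpa using ((hasDerivAt_id (0 : ℝ)).smul_const (L (u w))).const_add (fiberCoord w₀ w)
  have hm : mvfderiv 𝓘(ℝ, ℝ) (fun t : ℝ => fiberCoord w₀ w + t • L (u w)) 0 (1 : ℝ) = L (u w) := by
    rw [mvfderiv_modelSpace_apply, fderiv_apply_one_eq_deriv, hd.deriv]
  rw [hbase, ← hcomp, hev.mvfderiv_eq, hm]

end Coordinates

/-! ### The almost-tangent structure and the Lie ring of vector fields. -/

section Fields

variable {E : Type*} [NormedAddCommGroup E] [NormedSpace ℝ E]
  {M : Type*} [TopologicalSpace M] [ChartedSpace E M] [IsManifold 𝓘(ℝ, E) ∞ M]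

theorem mem_coordDomain_self (w : SlitTangentBundle E M) : w ∈ coordDomain w :=
  mem_chart_source E w.1.proj

theorem VectorField.ext_coord {X Y : VectorField E M}
    (h₁ : ∀ w, dBase w w (X w) = dBase w w (Y w))
    (h₂ : ∀ w, dFiber w w (X w) = dFiber w w (Y w)) : X = Y :=
  ContMDiffSection.ext fun w => SprayGeometry.ext_coord (mem_coordDomain_self w) (h₁ w) (h₂ w)

variable {w₀ w : SlitTangentBundle E M}

theorem dBase_of_vertical (hw : w ∈ coordDomain w₀) (V : VerticalField E M) :
    dBase w₀ w (V.1 w) = 0 :=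
  (dBase_eq_zero_iff hw _).2 (V.2 w)

theorem dFiber_almostTangent (hw : w ∈ coordDomain w₀) (X : VectorField E M) :
    dFiber w₀ w ((almostTangent X).1 w) = dBase w₀ w (X w) :=
  (dFiber_verticalLift hw (fun w => dproj w (X w))
    ((contMDiff_proj.contMDiff_tangentMap (m := ∞) (by simp)).comp X.contMDiff)).trans
    (dBase_eq hw _).symm

theorem dFiber_canonicalField (hw : w ∈ coordDomain w₀) :
    dFiber w₀ w ((canonicalField : VerticalField E M).1 w) = fiberCoord w₀ w :=
  (dFiber_verticalLift hw (fun w => w.1.snd) contMDiff_subtype_val).trans (fiberCoord_eq hw).symm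

/-- Both sides are vertical, so their base components vanish and only fibre components need
comparing; that of `𝒥X` is the base component of `X`. -/
theorem almostTangent_ext {X : VectorField E M} {V : VerticalField E M}
    (h : ∀ w, dFiber w w (V.1 w) = dBase w w (X w)) : almostTangent X = V := by
  refine Subtype.ext (VectorField.ext_coord (fun w => ?_) fun w => ?_)
  · rw [dBase_of_vertical (mem_coordDomain_self w), dBase_of_vertical (mem_coordDomain_self w)]
  · rw [dFiber_almostTangent (mem_coordDomain_self w), h]

/-- The almost-tangent structure as a tensor field. -/
def almostTangentHom : VectorField E M →ₗ[SmoothFun E M] VerticalField E M where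
  toFun := almostTangent
  map_add' X Y := almostTangent_ext fun w => by
    have hw := mem_coordDomain_self w
    have h := map_add (dFiber w w) ((almostTangent X).1 w) ((almostTangent Y).1 w)
    rw [dFiber_almostTangent hw, dFiber_almostTangent hw] at h
    exact h.trans (map_add (dBase w w) (X w) (Y w)).symm
  map_smul' f X := almostTangent_ext fun w => by
    have hw := mem_coordDomain_self w
    have h := map_smul (dFiber w w) (f w) ((almostTangent X).1 w)
    rw [dFiber_almostTangent hw] at h
    exact h.trans (map_smul (dBase w w) (f w) (X w)).symm

theorem almostTangent_zero : almostTangent (0 : VectorField E M) = 0 := map_zero almostTangentHom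

theorem almostTangent_add (X Y : VectorField E M) :
    almostTangent (X + Y) = almostTangent X + almostTangent Y := map_add almostTangentHom X Y

theorem almostTangent_sub (X Y : VectorField E M) :
    almostTangent (X - Y) = almostTangent X - almostTangent Y := map_sub almostTangentHom X Y

theorem almostTangent_neg (X : VectorField E M) :
    almostTangent (-X) = -almostTangent X := map_neg almostTangentHom X

theorem almostTangent_smul (f : SmoothFun E M) (X : VectorField E M) :
    almostTangent (f • X) = f • almostTangent X := map_smul almostTangentHom f X

theorem almostTangent_eq_zero_iff {X : VectorField E M} :
    almostTangent X = 0 ↔ X ∈ VerticalField E M := by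
  constructor
  · intro h w
    have hw := mem_coordDomain_self w
    rw [← dBase_eq_zero_iff hw, ← dFiber_almostTangent hw, h]
    exact map_zero (dFiber w w)
  · intro h
    refine almostTangent_ext fun w => ?_
    rw [(dBase_eq_zero_iff (mem_coordDomain_self w) _).2 (h w)]
    exact map_zero (dFiber w w)

theorem almostTangent_vertical (V : VerticalField E M) : almostTangent (V : VectorField E M) = 0 :=
  almostTangent_eq_zero_iff.2 V.2

/-- The derivative of a smooth function along a vector field, as a smooth function. -/
def lieDerivative (X : VectorField E M) (f : SmoothFun E M) : SmoothFun E M :=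
  ⟨fun w => mfderiv 𝓘(ℝ, E).tangent 𝓘(ℝ, ℝ) f w (X w),
    (contMDiff_snd_tangentBundle_modelSpace ℝ 𝓘(ℝ, ℝ)).comp
      ((f.contMDiff.contMDiff_tangentMap (m := ∞) (by simp)).comp X.contMDiff)⟩

variable [FiniteDimensional ℝ E]

instance instLieRingVectorField : LieRing (VectorField E M) where
  bracket := lieBracket
  add_lie X Y Z := by
    have := FiniteDimensional.complete ℝ E
    have : IsManifold 𝓘(ℝ, E).tangent 2 (SlitTangentBundle E M) := inferInstance
    ext w
    exact VectorField.mlieBracket_add_left (X.contMDiff.mdifferentiableAt (by simp))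
      (Y.contMDiff.mdifferentiableAt (by simp))
  lie_add X Y Z := by
    have := FiniteDimensional.complete ℝ E
    have : IsManifold 𝓘(ℝ, E).tangent 2 (SlitTangentBundle E M) := inferInstance
    ext w
    exact VectorField.mlieBracket_add_right (Y.contMDiff.mdifferentiableAt (by simp))
      (Z.contMDiff.mdifferentiableAt (by simp))
  lie_self X := by
    ext w
    exact congrFun (VectorField.mlieBracket_self (I := 𝓘(ℝ, E).tangent) (V := X)) w
  leibniz_lie X Y Z := by
    have := FiniteDimensional.complete ℝ E
    have : IsManifold 𝓘(ℝ, E).tangent (minSmoothness ℝ 3) (SlitTangentBundle E M) := by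
      rw [minSmoothness_of_isRCLikeNormedField]
      infer_instance
    have h (U : VectorField E M) (w : SlitTangentBundle E M) :
        ContMDiffAt 𝓘(ℝ, E).tangent 𝓘(ℝ, E).tangent.tangent (minSmoothness ℝ 2)
          (fun w => (⟨w, U w⟩ : TangentBundle 𝓘(ℝ, E).tangent (SlitTangentBundle E M))) w := by
      rw [minSmoothness_of_isRCLikeNormedField]
      exact U.contMDiff.contMDiffAt.of_le (WithTop.coe_le_coe.2 le_top)
    ext w
    exact VectorField.leibniz_identity_mlieBracket_apply (h X w) (h Y w) (h Z w)

theorem lieBracket_eq (X Y : VectorField E M) : lieBracket X Y = ⁅X, Y⁆ := rfl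

theorem lie_smul_right (X Y : VectorField E M) (f : SmoothFun E M) :
    ⁅X, f • Y⁆ = f • ⁅X, Y⁆ + lieDerivative X f • Y := by
  have := FiniteDimensional.complete ℝ E
  have : IsManifold 𝓘(ℝ, E).tangent 2 (SlitTangentBundle E M) := inferInstance
  ext w
  exact (VectorField.mlieBracket_smul_right (V := X) (W := Y)
    (f.contMDiff.mdifferentiableAt (by simp)) (Y.contMDiff.mdifferentiableAt (by simp))).trans
    (add_comm _ _)

theorem lie_smul_left (X Y : VectorField E M) (f : SmoothFun E M) :
    ⁅f • X, Y⁆ = f • ⁅X, Y⁆ - lieDerivative Y f • X := by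
  rw [← lie_skew, lie_smul_right, ← lie_skew Y X, smul_neg]
  abel

/-- These are the two components of the chart formula for the bracket. The differential of the chart
splits as `(dBase, dFiber)` only on the chart domain, hence the eventual equalities. -/
theorem coord_lie (X Y : VectorField E M) (w : SlitTangentBundle E M) :
    dBase w w (⁅X, Y⁆ w) =
        mvfderiv 𝓘(ℝ, E).tangent (fun z => dBase w z (Y z)) w (X w) -
          mvfderiv 𝓘(ℝ, E).tangent (fun z => dBase w z (X z)) w (Y w) ∧
      dFiber w w (⁅X, Y⁆ w) =
        mvfderiv 𝓘(ℝ, E).tangent (fun z => dFiber w z (Y z)) w (X w) -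
          mvfderiv 𝓘(ℝ, E).tangent (fun z => dFiber w z (X z)) w (Y w) := by
  have := FiniteDimensional.complete ℝ E
  have : IsManifold 𝓘(ℝ, E).tangent 2 (SlitTangentBundle E M) := inferInstance
  have hd (U : VectorField E M) := U.contMDiff.mdifferentiableAt (x := w) (by simp)
  have hc (U : VectorField E M) := VectorField.mdifferentiableAt_mvfderiv_extChartAt (hd U)
  have h := VectorField.mvfderiv_extChartAt_mlieBracket (hd X) (hd Y)
  have e (U : VectorField E M) :
      (fun z => mvfderiv 𝓘(ℝ, E).tangent (extChartAt 𝓘(ℝ, E).tangent w) z (U z)) =ᶠ[𝓝 w]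
        fun z => (dBase w z (U z), dFiber w z (U z)) := by
    filter_upwards [coordDomain_mem_nhds w] with z hz
    exact mvfderiv_extChartAt_slitTangentBundle hz _
  have e₁ (U W : VectorField E M) :
      mvfderiv 𝓘(ℝ, E).tangent (fun z => dBase w z (U z)) w (W w) =
      (mvfderiv 𝓘(ℝ, E).tangent (fun z => mvfderiv 𝓘(ℝ, E).tangent
        (extChartAt 𝓘(ℝ, E).tangent w) z (U z)) w (W w)).1 := by
    refine Eq.trans ?_ (ContinuousLinearMap.mvfderiv_comp_apply (.fst ℝ E E) (hc U) _)
    refine DFunLike.congr_fun (Filter.EventuallyEq.mvfderiv_eq ?_) _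
    filter_upwards [e U] with z hz
    exact (congrArg Prod.fst hz).symm
  have e₂ (U W : VectorField E M) :
      mvfderiv 𝓘(ℝ, E).tangent (fun z => dFiber w z (U z)) w (W w) =
      (mvfderiv 𝓘(ℝ, E).tangent (fun z => mvfderiv 𝓘(ℝ, E).tangent
        (extChartAt 𝓘(ℝ, E).tangent w) z (U z)) w (W w)).2 := by
    refine Eq.trans ?_ (ContinuousLinearMap.mvfderiv_comp_apply (.snd ℝ E E) (hc U) _)
    refine DFunLike.congr_fun (Filter.EventuallyEq.mvfderiv_eq ?_) _
    filter_upwards [e U] with z hz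
    exact (congrArg Prod.snd hz).symm
  have h' :=
    (mvfderiv_extChartAt_slitTangentBundle (mem_coordDomain_self w) (⁅X, Y⁆ w)).symm.trans h
  rw [e₁, e₁, e₂, e₂]
  exact ⟨congrArg Prod.fst h', congrArg Prod.snd h'⟩

end Fields

/-! ### The canonical connection and its projections. -/

section Projections

variable {E : Type*} [NormedAddCommGroup E] [NormedSpace ℝ E]
  {M : Type*} [TopologicalSpace M] [ChartedSpace E M] [IsManifold 𝓘(ℝ, E) ∞ M]

theorem mvfderiv_dBase_vertical (V : VerticalField E M) (w : SlitTangentBundle E M)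
    (ξ : TangentSpace 𝓘(ℝ, E).tangent w) :
    mvfderiv 𝓘(ℝ, E).tangent (fun z => dBase w z (V.1 z)) w ξ = 0 := by
  have h : (fun z => dBase w z (V.1 z)) =ᶠ[𝓝 w] fun _ => (0 : E) := by
    filter_upwards [coordDomain_mem_nhds w] with z hz using dBase_of_vertical hz V
  rw [h.mvfderiv_eq, mvfderiv_const]
  rfl

/-- Turns the real factor 1/2 in `ℋ` and `𝒱` into a constant function, so that linearity over smooth
functions applies. -/
theorem real_smul_eq (c : ℝ) (X : VectorField E M) :
    c • X = algebraMap ℝ (SmoothFun E M) c • X := by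
  ext w
  rfl

theorem add_half_smul_half (X : VectorField E M) :
    algebraMap ℝ (SmoothFun E M) (1 / 2) • X + algebraMap ℝ (SmoothFun E M) (1 / 2) • X = X := by
  rw [← add_smul, ← map_add, add_halves, map_one, one_smul]

variable [FiniteDimensional ℝ E]

theorem dBase_lie_vertical_left (V : VerticalField E M) (X : VectorField E M)
    (w : SlitTangentBundle E M) :
    dBase w w (⁅(V : VectorField E M), X⁆ w) =
      mvfderiv 𝓘(ℝ, E).tangent (fun z => dBase w z (X z)) w (V.1 w) := by
  rw [(coord_lie V X w).1, mvfderiv_dBase_vertical, sub_zero]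

theorem lie_mem_verticalField (V W : VerticalField E M) :
    ⁅(V : VectorField E M), (W : VectorField E M)⁆ ∈ VerticalField E M := fun w =>
  (dBase_eq_zero_iff (mem_coordDomain_self w) _).1 <| by
    rw [dBase_lie_vertical_left, mvfderiv_dBase_vertical]

theorem almostTangent_lie_vertical (V W : VerticalField E M) :
    almostTangent ⁅(V : VectorField E M), (W : VectorField E M)⁆ = 0 :=
  almostTangent_eq_zero_iff.2 (lie_mem_verticalField V W)

/-- If `𝒥 S = C`, then `V ↦ [V, S]` is a right inverse of `𝒥` on vertical fields. -/
theorem almostTangent_lie_of_semispray {S : VectorField E M} (hS : almostTangent S = canonicalField)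
    (V : VerticalField E M) : almostTangent ⁅(V : VectorField E M), S⁆ = V := by
  refine almostTangent_ext fun w => ?_
  -- In coordinates, `𝒥S = C` says that the base component of `S` is the fibre coordinate.
  have h : (fun z => dBase w z (S z)) =ᶠ[𝓝 w] fiberCoord w := by
    filter_upwards [coordDomain_mem_nhds w] with z hz
    rw [← dFiber_almostTangent hz, hS, dFiber_canonicalField hz]
  rw [dBase_lie_vertical_left, h.mvfderiv_eq]
  rfl

/-- The almost-tangent structure is homogeneous of degree `-1`: `[C, 𝒥] = -𝒥`. -/
theorem lie_canonicalField_almostTangent (X : VectorField E M) :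
    ⁅((canonicalField : VerticalField E M) : VectorField E M),
        (almostTangent X : VectorField E M)⁆ =
      almostTangent ⁅((canonicalField : VerticalField E M) : VectorField E M), X⁆ -
        almostTangent X := by
  refine VectorField.ext_coord (fun w => ?_) fun w => ?_
  · have hw := mem_coordDomain_self w
    rw [dBase_lie_vertical_left, mvfderiv_dBase_vertical]
    exact (dBase_of_vertical hw (almostTangent ⁅_, X⁆ - almostTangent X)).symm
  · have hw := mem_coordDomain_self w
    have h₁ : (fun z => dFiber w z ((almostTangent X).1 z)) =ᶠ[𝓝 w] fun z => dBase w z (X z) := by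
      filter_upwards [coordDomain_mem_nhds w] with z hz using dFiber_almostTangent hz X
    have h₂ : (fun z => dFiber w z ((canonicalField : VerticalField E M).1 z)) =ᶠ[𝓝 w]
        fiberCoord w := by
      filter_upwards [coordDomain_mem_nhds w] with z hz using dFiber_canonicalField hz
    -- The fibre component of `[C, 𝒥X]` is `C(dx(X)) - (𝒥X)(y)`: the first term is `dx([C, X])`, the
    -- second is the fibre component of `𝒥X`.
    rw [(coord_lie _ _ w).2, h₁.mvfderiv_eq, h₂.mvfderiv_eq, ← dBase_lie_vertical_left,
      ← dFiber_almostTangent hw]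
    exact (map_sub (dFiber w w) _ _).symm

theorem canonicalConnection_eq (S X : VectorField E M) :
    canonicalConnection S X = ⁅(almostTangent X : VectorField E M), S⁆ + almostTangent ⁅S, X⁆ := by
  rw [canonicalConnection, lieBracket_eq, lieBracket_eq, ← lie_skew S]
  abel

/-- The canonical connection as a tensor field. -/
def canonicalConnectionHom (S : VectorField E M) :
    VectorField E M →ₗ[SmoothFun E M] VectorField E M where
  toFun := canonicalConnection S
  map_add' X Y := by
    simp only [canonicalConnection_eq, almostTangent_add, lie_add, Submodule.coe_add, add_lie]
    abel
  map_smul' f X := by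
    -- The terms `-(Sf) 𝒥X` from `[f𝒥X, S]` and `(Sf) 𝒥X` from `𝒥[S, fX]` cancel.
    simp only [canonicalConnection_eq, almostTangent_add, almostTangent_smul, lie_smul_right,
      lie_smul_left, Submodule.coe_add, Submodule.coe_smul, RingHom.id_apply, smul_add]
    abel

/-- The horizontal projection as a tensor field. -/
def horizontalHom (S : VectorField E M) : VectorField E M →ₗ[SmoothFun E M] VectorField E M where
  toFun := horizontalPart S
  map_add' X Y := by
    have h := map_add (canonicalConnectionHom S) X Y
    simp only [horizontalPart, ← smul_add]
    exact congrArg _ ((congrArg _ h).trans (add_add_add_comm _ _ _ _))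
  map_smul' f X := by
    have h := map_smul (canonicalConnectionHom S) f X
    simp only [horizontalPart, real_smul_eq, RingHom.id_apply, smul_comm f, smul_add]
    exact congrArg (_ + _ • ·) h |>.trans (by rw [smul_comm]; rfl)

theorem horizontalPart_add (S X Y : VectorField E M) :
    horizontalPart S (X + Y) = horizontalPart S X + horizontalPart S Y :=
  map_add (horizontalHom S) X Y

theorem horizontalPart_smul (S : VectorField E M) (f : SmoothFun E M) (X : VectorField E M) :
    horizontalPart S (f • X) = f • horizontalPart S X := map_smul (horizontalHom S) f X

theorem horizontalPart_add_verticalPart (S X : VectorField E M) :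
    horizontalPart S X + verticalPart S X = X := by
  rw [horizontalPart, verticalPart, real_smul_eq, real_smul_eq, smul_add, smul_sub,
    add_add_sub_cancel, add_half_smul_half]

theorem verticalPart_eq (S X : VectorField E M) : verticalPart S X = X - horizontalPart S X :=
  eq_sub_of_add_eq' (horizontalPart_add_verticalPart S X)

variable {S : VectorField E M}

theorem canonicalConnection_eq_self_iff (X : VectorField E M) :
    canonicalConnection S X = X ↔ verticalPart S X = 0 := by
  constructor
  · intro h
    rw [verticalPart, h, sub_self, smul_zero]
  · intro h
    have h' := add_half_smul_half (X - canonicalConnection S X)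
    rw [← real_smul_eq, ← verticalPart, h, add_zero] at h'
    exact (sub_eq_zero.1 h'.symm).symm

/-! ### Consequences of `𝒥S = C`: complementary projections. -/

section Semispray

variable (hS : almostTangent S = canonicalField)
include hS

theorem canonicalConnection_vertical (V : VerticalField E M) : canonicalConnection S V = -V := by
  rw [canonicalConnection_eq, almostTangent_vertical, ← lie_skew S (V : VectorField E M),
    almostTangent_neg, almostTangent_lie_of_semispray hS]
  simp

theorem almostTangent_canonicalConnection (X : VectorField E M) :
    almostTangent (canonicalConnection S X) = almostTangent X := by
  rw [canonicalConnection_eq, almostTangent_add, almostTangent_lie_of_semispray hS,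
    almostTangent_vertical, add_zero]

theorem horizontalPart_vertical (V : VerticalField E M) : horizontalPart S V = 0 := by
  rw [horizontalPart, canonicalConnection_vertical hS, add_neg_cancel, smul_zero]

/-- `ℋ` kills vertical fields, which form the kernel of `𝒥`; hence `ℋX` depends on `𝒥X` alone. -/
theorem horizontalPart_eq_of_almostTangent_eq {X Y : VectorField E M}
    (h : almostTangent X = almostTangent Y) : horizontalPart S X = horizontalPart S Y := by
  have hv : X - Y ∈ VerticalField E M := by
    rw [← almostTangent_eq_zero_iff, almostTangent_sub, h, sub_self]
  have h' := horizontalPart_vertical hS ⟨X - Y, hv⟩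
  exact sub_eq_zero.1 ((map_sub (horizontalHom S) X Y).symm.trans h')

theorem almostTangent_horizontalPart (X : VectorField E M) :
    almostTangent (horizontalPart S X) = almostTangent X := by
  rw [horizontalPart, real_smul_eq, almostTangent_smul, almostTangent_add,
    almostTangent_canonicalConnection hS, smul_add]
  exact Subtype.ext (add_half_smul_half _)

theorem verticalPart_mem (X : VectorField E M) : verticalPart S X ∈ VerticalField E M := by
  rw [← almostTangent_eq_zero_iff, verticalPart_eq, almostTangent_sub,
    almostTangent_horizontalPart hS, sub_self]

theorem verticalPart_vertical (V : VerticalField E M) : verticalPart S V = V := by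
  rw [verticalPart_eq, horizontalPart_vertical hS, sub_zero]

theorem horizontalPart_horizontalPart (X : VectorField E M) :
    horizontalPart S (horizontalPart S X) = horizontalPart S X :=
  horizontalPart_eq_of_almostTangent_eq hS (almostTangent_horizontalPart hS X)

theorem verticalPart_horizontalPart (X : VectorField E M) :
    verticalPart S (horizontalPart S X) = 0 := by
  rw [verticalPart_eq, horizontalPart_horizontalPart hS, sub_self]

/-- The vertical projection as a tensor field with values in the vertical bundle. -/
def verticalHom : VectorField E M →ₗ[SmoothFun E M] VerticalField E M :=
  (LinearMap.id - horizontalHom S).codRestrict (VerticalField E M) fun X => by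
    have h := verticalPart_mem hS X
    rwa [verticalPart_eq] at h

theorem coe_verticalHom (X : VectorField E M) :
    (verticalHom hS X : VectorField E M) = verticalPart S X :=
  (verticalPart_eq S X).symm

theorem verticalHom_vertical (V : VerticalField E M) : verticalHom hS (V : VectorField E M) = V :=
  Subtype.ext ((coe_verticalHom hS V).trans (verticalPart_vertical hS V))

theorem verticalHom_horizontalPart (X : VectorField E M) :
    verticalHom hS (horizontalPart S X) = 0 :=
  Subtype.ext ((coe_verticalHom hS _).trans (verticalPart_horizontalPart hS X))

/-- Reduces uniqueness statements to fields of the forms `ℋX` and `𝒥Z`, by writing `𝒱X = 𝒥[𝒱X, S]`.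
-/
theorem horizontalPart_add_almostTangent (X : VectorField E M) :
    X = horizontalPart S X + almostTangent ⁅(verticalHom hS X : VectorField E M), S⁆ := by
  rw [almostTangent_lie_of_semispray hS, coe_verticalHom, horizontalPart_add_verticalPart]

end Semispray

/-! ### Consequences of homogeneity. -/

section Spray

variable (hS : IsSpray S)
include hS

theorem lie_canonicalField_spray :
    ⁅((canonicalField : VerticalField E M) : VectorField E M), S⁆ = S := hS.homogeneous

/-- Expand `[C, Γ_S X]` by the Jacobi identity: the degree -1 of `𝒥` and the degree 1 of `S` cancel.
-/
theorem lie_canonicalField_canonicalConnection (X : VectorField E M) :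
    ⁅((canonicalField : VerticalField E M) : VectorField E M), canonicalConnection S X⁆ =
      canonicalConnection S ⁅((canonicalField : VerticalField E M) : VectorField E M), X⁆ := by
  rw [canonicalConnection_eq, canonicalConnection_eq, lie_add, leibniz_lie,
    lie_canonicalField_almostTangent, lie_canonicalField_almostTangent, leibniz_lie _ S X,
    lie_canonicalField_spray hS, sub_lie, almostTangent_add, Submodule.coe_add]
  abel

theorem lie_canonicalField_horizontalPart (X : VectorField E M) :
    ⁅((canonicalField : VerticalField E M) : VectorField E M), horizontalPart S X⁆ =
      horizontalPart S ⁅((canonicalField : VerticalField E M) : VectorField E M), X⁆ := by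
  have h (c : ℝ) (Y Z : VectorField E M) : ⁅Y, c • Z⁆ = c • ⁅Y, Z⁆ := by
    have hd : lieDerivative Y (algebraMap ℝ (SmoothFun E M) c) = 0 := by
      ext w
      exact DFunLike.congr_fun (mvfderiv_const (I := 𝓘(ℝ, E).tangent) (x := w) c) (Y w)
    rw [real_smul_eq, lie_smul_right, hd, zero_smul, add_zero, real_smul_eq]
  rw [horizontalPart, h, lie_add, lie_canonicalField_canonicalConnection hS, horizontalPart]

/-- `[C, ·]` commutes with `ℋ`, so `[ℋX, C]` is again horizontal. This gives `∇*_{ℋX} C = 0`. -/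
theorem verticalHom_lie_horizontalPart_canonicalField (X : VectorField E M) :
    verticalHom hS.almostTangent_eq
      ⁅horizontalPart S X, ((canonicalField : VerticalField E M) : VectorField E M)⁆ = 0 := by
  rw [← lie_skew, lie_canonicalField_horizontalPart hS, map_neg, verticalHom_horizontalPart,
    neg_zero]

end Spray
end Projections

/-! ### Linear connections and semi-basic tensors. -/

section Connections

variable {E : Type*} [NormedAddCommGroup E] [NormedSpace ℝ E]
  {M : Type*} [TopologicalSpace M] [ChartedSpace E M] [IsManifold 𝓘(ℝ, E) ∞ M]

theorem lieDerivative_add (X Y : VectorField E M) (f : SmoothFun E M) :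
    lieDerivative (X + Y) f = lieDerivative X f + lieDerivative Y f := by
  ext w
  exact map_add (mvfderiv 𝓘(ℝ, E).tangent f w) (X w) (Y w)

namespace LinearConnection

variable (D : LinearConnection E M)

theorem leibniz' (f : SmoothFun E M) (X : VectorField E M) (V : VerticalField E M) :
    D X (f • V) = f • D X V + lieDerivative X f • V := by
  ext w
  exact D.leibniz f X V w

theorem zero_right (X : VectorField E M) : D X 0 = 0 := by
  simpa using D.add_right X 0 0

/-- The difference of two linear connections is a tensor field. -/
def difference (D D' : LinearConnection E M) :
    VectorField E M →ₗ[SmoothFun E M] VerticalField E M →ₗ[SmoothFun E M] VerticalField E M :=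
  LinearMap.mk₂ _ (fun X V => D X V - D' X V)
    (fun X Y V => by rw [D.add_left, D'.add_left, add_sub_add_comm])
    (fun f X V => by rw [D.smul_left, D'.smul_left, smul_sub])
    (fun X V W => by rw [D.add_right, D'.add_right, add_sub_add_comm])
    (fun f X V => by rw [D.leibniz', D'.leibniz', add_sub_add_right_eq_sub, smul_sub])

theorem difference_apply (D D' : LinearConnection E M) (X : VectorField E M)
    (V : VerticalField E M) : difference D D' X V = D X V - D' X V := rfl

/-- A linear connection from its Leibniz rule as an identity of vertical fields. -/
def ofLeibniz (D : VectorField E M → VerticalField E M → VerticalField E M)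
    (add_left : ∀ X Y V, D (X + Y) V = D X V + D Y V)
    (smul_left : ∀ (f : SmoothFun E M) X V, D (f • X) V = f • D X V)
    (add_right : ∀ X V W, D X (V + W) = D X V + D X W)
    (leibniz : ∀ (f : SmoothFun E M) X V, D X (f • V) = f • D X V + lieDerivative X f • V) :
    LinearConnection E M where
  toFun := D
  add_left := add_left
  smul_left := smul_left
  add_right := add_right
  leibniz f X V w := by
    rw [leibniz]
    rfl

/-- Translation of a linear connection by a tensor field. -/
def translate
    (T : VectorField E M →ₗ[SmoothFun E M] VerticalField E M →ₗ[SmoothFun E M] VerticalField E M) :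
    LinearConnection E M :=
  ofLeibniz (fun X V => D X V + T X V)
    (fun X Y V => (congrArg₂ (· + ·) (D.add_left X Y V)
      (LinearMap.congr_fun (T.map_add X Y) V)).trans
      (add_add_add_comm _ _ _ _))
    (fun f X V => (congrArg₂ (· + ·) (D.smul_left f X V)
      (LinearMap.congr_fun (T.map_smul f X) V)).trans (smul_add _ _ _).symm)
    (fun X V W => (congrArg₂ (· + ·) (D.add_right X V W) ((T X).map_add V W)).trans
      (add_add_add_comm _ _ _ _))
    (fun f X V => (congrArg₂ (· + ·) (D.leibniz' f X V) ((T X).map_smul f V)).trans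
      ((add_right_comm _ _ _).trans (congrArg (· + _) (smul_add _ _ _).symm)))

end LinearConnection

/-- Fields with equal image under `𝒥` differ by a vertical field, which a semi-basic tensor ignores.
-/
theorem IsSemibasic.congr {T : VerticalTensor E M} (hT : IsSemibasic T)
    {X X' Y Y' : VectorField E M}
    (hX : almostTangent X = almostTangent X') (hY : almostTangent Y = almostTangent Y') :
    T X Y = T X' Y' := by
  have h₁ : T (X - X') Y = 0 := hT _ _ (.inl (by
    rw [← almostTangent_eq_zero_iff, almostTangent_sub, hX, sub_self]))
  have h₂ : T X' (Y - Y') = 0 := hT _ _ (.inr (by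
    rw [← almostTangent_eq_zero_iff, almostTangent_sub, hY, sub_self]))
  rw [map_sub, LinearMap.sub_apply, sub_eq_zero] at h₁
  rw [map_sub, sub_eq_zero] at h₂
  exact h₁.trans h₂

variable [FiniteDimensional ℝ E]

theorem almostTangent_lie_smul_left (X Y : VectorField E M) (f : SmoothFun E M) :
    almostTangent ⁅f • X, Y⁆ = f • almostTangent ⁅X, Y⁆ - lieDerivative Y f • almostTangent X := by
  rw [lie_smul_left, almostTangent_sub, almostTangent_smul, almostTangent_smul]

theorem almostTangent_lie_smul_right (X Y : VectorField E M) (f : SmoothFun E M) :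
    almostTangent ⁅X, f • Y⁆ = f • almostTangent ⁅X, Y⁆ + lieDerivative X f • almostTangent Y := by
  rw [lie_smul_right, almostTangent_add, almostTangent_smul, almostTangent_smul]

variable {S : VectorField E M}

/-! ### The almost-complex structure and the Berwald connection. -/

section Semispray

variable (hS : almostTangent S = canonicalField)

/-- The almost-complex structure `ℱ X = ℋ[𝒱X, S] - 𝒥X`. -/
def almostComplexStructure : VectorField E M →ₗ[SmoothFun E M] VectorField E M where
  toFun X := horizontalPart S ⁅(verticalHom hS X : VectorField E M), S⁆ - almostTangent X
  map_add' X Y := by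
    rw [map_add, Submodule.coe_add, add_lie, almostTangent_add, Submodule.coe_add]
    exact (congrArg (· - _) (map_add (horizontalHom S) _ _)).trans (add_sub_add_comm _ _ _ _)
  map_smul' f X := by
    rw [map_smul, Submodule.coe_smul, lie_smul_left, almostTangent_smul, Submodule.coe_smul,
      ← Submodule.coe_smul, RingHom.id_apply, smul_sub]
    refine congrArg (· - _) (Eq.trans ?_ (map_smul (horizontalHom S) f _))
    -- `[f𝒱X, S]` and `f[𝒱X, S]` differ by a multiple of `𝒱X`, which `ℋ` kills.
    refine horizontalPart_eq_of_almostTangent_eq hS ?_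
    rw [almostTangent_sub, almostTangent_vertical, sub_zero]

theorem almostComplexStructure_apply (X : VectorField E M) :
    almostComplexStructure hS X =
      horizontalPart S ⁅(verticalHom hS X : VectorField E M), S⁆ - almostTangent X := rfl

theorem isAlmostComplexStructure_almostComplexStructure :
    IsAlmostComplexStructure S (almostComplexStructure hS) where
  comp_almostTangent X := by
    rw [almostComplexStructure_apply, verticalHom_vertical, almostTangent_vertical,
      ZeroMemClass.coe_zero, sub_zero]
    exact horizontalPart_eq_of_almostTangent_eq hS (almostTangent_lie_of_semispray hS _)
  comp_horizontal X := by
    rw [almostComplexStructure_apply, verticalHom_horizontalPart, ZeroMemClass.coe_zero, zero_lie,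
      almostTangent_horizontalPart hS]
    exact (congrArg (· - _) (map_zero (horizontalHom S))).trans (zero_sub _)

include hS in
theorem IsAlmostComplexStructure.unique
    {F F' : VectorField E M →ₗ[SmoothFun E M] VectorField E M}
    (hF : IsAlmostComplexStructure S F) (hF' : IsAlmostComplexStructure S F') : F = F' := by
  ext1 X
  rw [horizontalPart_add_almostTangent hS X, map_add, map_add, hF.comp_almostTangent,
    hF.comp_horizontal, hF'.comp_almostTangent, hF'.comp_horizontal]

theorem lieDerivative_verticalHom_add_horizontalPart (X : VectorField E M) (f : SmoothFun E M) :
    lieDerivative (verticalHom hS X : VectorField E M) f + lieDerivative (horizontalPart S X) f =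
      lieDerivative X f := by
  rw [← lieDerivative_add, coe_verticalHom, add_comm, horizontalPart_add_verticalPart]

theorem verticalHom_lie_smul_left (X Y : VectorField E M) (f : SmoothFun E M) :
    verticalHom hS ⁅f • X, Y⁆ =
      f • verticalHom hS ⁅X, Y⁆ - lieDerivative Y f • verticalHom hS X := by
  rw [lie_smul_left]
  exact ((verticalHom hS).map_sub _ _).trans
    (congrArg₂ _ ((verticalHom hS).map_smul _ _) ((verticalHom hS).map_smul _ _))

theorem verticalHom_lie_smul_right (X Y : VectorField E M) (f : SmoothFun E M) :
    verticalHom hS ⁅X, f • Y⁆ =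
      f • verticalHom hS ⁅X, Y⁆ + lieDerivative X f • verticalHom hS Y := by
  rw [lie_smul_right]
  exact ((verticalHom hS).map_add _ _).trans
    (congrArg₂ _ ((verticalHom hS).map_smul _ _) ((verticalHom hS).map_smul _ _))

theorem almostTangent_lie_lie_add (X Y Z S : VectorField E M) :
    almostTangent ⁅X, ⁅Y + Z, S⁆⁆ = almostTangent ⁅X, ⁅Y, S⁆⁆ + almostTangent ⁅X, ⁅Z, S⁆⁆ := by
  rw [add_lie, lie_add, almostTangent_add]

include hS in
-- The term `(Sf)V` in `[fV, S]` contributes only vertical fields after bracketing with `W`, and `𝒥`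
-- kills them. The Leibniz term `(Wf)V` comes from `(Wf) 𝒥[V, S]`.
theorem almostTangent_lie_lie_smul (W V : VerticalField E M) (f : SmoothFun E M) :
    almostTangent ⁅(W : VectorField E M), ⁅f • (V : VectorField E M), S⁆⁆ =
      f • almostTangent ⁅(W : VectorField E M), ⁅(V : VectorField E M), S⁆⁆ +
        lieDerivative (W : VectorField E M) f • V := by
  rw [lie_smul_left, lie_sub, almostTangent_sub, almostTangent_lie_smul_right,
    almostTangent_lie_smul_right, almostTangent_lie_vertical, almostTangent_vertical,
    almostTangent_lie_of_semispray hS, smul_zero, smul_zero, add_zero, sub_zero]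

/-- The Berwald derivative `∇_X V = 𝒥[𝒱X, [V, S]] + 𝒱[ℋX, V]`. -/
def berwaldDerivative (X : VectorField E M) (V : VerticalField E M) : VerticalField E M :=
  almostTangent ⁅(verticalHom hS X : VectorField E M), ⁅(V : VectorField E M), S⁆⁆ +
    verticalHom hS ⁅horizontalPart S X, (V : VectorField E M)⁆

theorem berwaldDerivative_add_left (X Y : VectorField E M) (V : VerticalField E M) :
    berwaldDerivative hS (X + Y) V = berwaldDerivative hS X V + berwaldDerivative hS Y V := by
  unfold berwaldDerivative
  rw [horizontalPart_add, (verticalHom hS).map_add X Y, Submodule.coe_add, add_lie, add_lie,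
    almostTangent_add]
  exact (congrArg (_ + ·) ((verticalHom hS).map_add _ _)).trans (add_add_add_comm _ _ _ _)

theorem berwaldDerivative_smul_left (f : SmoothFun E M) (X : VectorField E M)
    (V : VerticalField E M) :
    berwaldDerivative hS (f • X) V = f • berwaldDerivative hS X V := by
  unfold berwaldDerivative
  rw [horizontalPart_smul, (verticalHom hS).map_smul f X, Submodule.coe_smul,
    almostTangent_lie_smul_left, verticalHom_lie_smul_left, almostTangent_vertical,
    verticalHom_horizontalPart, smul_zero, smul_zero, sub_zero, sub_zero]
  exact (smul_add _ _ _).symm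

theorem berwaldDerivative_add_right (X : VectorField E M) (V W : VerticalField E M) :
    berwaldDerivative hS X (V + W) = berwaldDerivative hS X V + berwaldDerivative hS X W := by
  have h₁ := almostTangent_lie_lie_add (verticalHom hS X) V W S
  have h₂ := congrArg (verticalHom hS) (lie_add (horizontalPart S X) (V : VectorField E M) W)
  have h₃ := h₂.trans ((verticalHom hS).map_add _ _)
  have h₄ := congrArg₂ (· + ·) h₁ h₃
  exact h₄.trans (add_add_add_comm _ _ _ _)

/-- The two summands contribute `(𝒱X)f` and `(ℋX)f`, which add up to `Xf`. -/
theorem berwaldDerivative_smul_right (f : SmoothFun E M) (X : VectorField E M)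
    (V : VerticalField E M) :
    berwaldDerivative hS X (f • V) = f • berwaldDerivative hS X V + lieDerivative X f • V :=
  (congrArg₂ (· + ·) (almostTangent_lie_lie_smul hS (verticalHom hS X) V f)
    ((verticalHom_lie_smul_right hS (horizontalPart S X) V f).trans
      (congrArg (_ + _ • ·) (verticalHom_vertical hS V)))).trans
    ((add_add_add_comm _ _ _ _).trans (congrArg₂ (· + ·) (smul_add _ _ _).symm
      ((add_smul _ _ _).symm.trans
        (congrArg (· • V) (lieDerivative_verticalHom_add_horizontalPart hS X f)))))

/-- The Berwald connection `∇_X V = 𝒥[𝒱X, [V, S]] + 𝒱[ℋX, V]`. -/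
def berwald : LinearConnection E M :=
  .ofLeibniz (berwaldDerivative hS) (berwaldDerivative_add_left hS) (berwaldDerivative_smul_left hS)
    (berwaldDerivative_add_right hS) (berwaldDerivative_smul_right hS)

theorem berwald_apply (X : VectorField E M) (V : VerticalField E M) : berwald hS X V =
    almostTangent ⁅(verticalHom hS X : VectorField E M), ⁅(V : VectorField E M), S⁆⁆ +
      verticalHom hS ⁅horizontalPart S X, (V : VectorField E M)⁆ := rfl

/-- `[𝒥Y, S]` and `Y` have the same image under `𝒥`, so they differ by a vertical field. Its bracket
with `𝒥X` is vertical and is killed by `𝒥`. -/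
theorem berwald_almostTangent (X Y : VectorField E M) :
    berwald hS (almostTangent X) (almostTangent Y) =
      almostTangent (lieBracket (almostTangent X) Y) := by
  have h : ⁅(almostTangent Y : VectorField E M), S⁆ - Y ∈ VerticalField E M := by
    rw [← almostTangent_eq_zero_iff, almostTangent_sub, almostTangent_lie_of_semispray hS, sub_self]
  have h' := almostTangent_lie_vertical (almostTangent X) ⟨_, h⟩
  rw [lie_sub, almostTangent_sub] at h'
  rw [berwald_apply, verticalHom_vertical, horizontalPart_vertical hS, zero_lie, map_zero, add_zero]
  exact sub_eq_zero.1 h'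

theorem berwald_horizontalPart (X : VectorField E M) (V : VerticalField E M) :
    berwald hS (horizontalPart S X) V =
      verticalHom hS ⁅horizontalPart S X, (V : VectorField E M)⁆ := by
  rw [berwald_apply, verticalHom_horizontalPart, horizontalPart_horizontalPart hS,
    ZeroMemClass.coe_zero, zero_lie, almostTangent_zero, zero_add]

theorem isBerwald_berwald : IsBerwald S (berwald hS) where
  vertical := berwald_almostTangent hS
  horizontal X Y := by
    rw [berwald_horizontalPart, coe_verticalHom]
    rfl

include hS in
/-- Linear connections agreeing on `(𝒥X, 𝒥Y)` and `(ℋX, 𝒥Y)` are equal. -/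
theorem LinearConnection.ext_almostTangent {D D' : LinearConnection E M}
    (h₁ : ∀ X Y : VectorField E M, D (almostTangent X) (almostTangent Y) =
      D' (almostTangent X) (almostTangent Y))
    (h₂ : ∀ X Y : VectorField E M, D (horizontalPart S X) (almostTangent Y) =
      D' (horizontalPart S X) (almostTangent Y)) : D = D' := by
  refine LinearConnection.ext (funext fun X => funext fun V => ?_)
  rw [← almostTangent_lie_of_semispray hS V, horizontalPart_add_almostTangent hS X, D.add_left,
    D'.add_left, h₁, h₂]

include hS in
theorem IsBerwald.unique {D D' : LinearConnection E M} (hD : IsBerwald S D)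
    (hD' : IsBerwald S D') : D = D' :=
  LinearConnection.ext_almostTangent hS (fun X Y => (hD.vertical X Y).trans (hD'.vertical X Y).symm)
    fun X Y => Subtype.ext ((hD.horizontal X Y).trans (hD'.horizontal X Y).symm)

end Semispray

/-! ### Lifts and pairs of semi-basic tensors. -/

section Spray

variable (hS : IsSpray S)

theorem berwald_canonicalField (X : VectorField E M) :
    berwald hS.almostTangent_eq X canonicalField = verticalHom hS.almostTangent_eq X := by
  rw [berwald_apply, lie_canonicalField_spray hS,
    almostTangent_lie_of_semispray hS.almostTangent_eq,
    verticalHom_lie_horizontalPart_canonicalField hS, add_zero]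

include hS in
-- Merges both lift conditions into one equation by splitting `X = ℋX + 𝒱X`; differences of lifts
-- then visibly annihilate `C`.
theorem isLift_iff {D : LinearConnection E M} :
    IsLift S D ↔ ∀ X, D X canonicalField = verticalHom hS.almostTangent_eq X := by
  have hJ := hS.almostTangent_eq
  constructor
  · intro h X
    have hH : D (horizontalPart S X) canonicalField = 0 :=
      (h.ker_eq _).2 ((canonicalConnection_eq_self_iff _).2 (verticalPart_horizontalPart hJ X))
    conv_lhs => rw [← horizontalPart_add_verticalPart S X, ← coe_verticalHom hJ, D.add_left, hH,
      h.almostProjectable, zero_add]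
  · intro h
    refine ⟨fun X => (h X).trans (verticalHom_vertical hJ X), fun X => ?_⟩
    rw [h, canonicalConnection_eq_self_iff, ← coe_verticalHom hJ, ZeroMemClass.coe_eq_zero]

theorem isLift_berwald : IsLift S (berwald hS.almostTangent_eq) :=
  (isLift_iff hS).2 (berwald_canonicalField hS)

/-- A semi-basic tensor field, as a tensor field whose second argument is `𝒥 Y` in place of `Y`. -/
def IsSemibasic.descend {T : VerticalTensor E M} (hT : IsSemibasic T)
    (hS : almostTangent S = canonicalField) :
    VectorField E M →ₗ[SmoothFun E M] VerticalField E M →ₗ[SmoothFun E M] VerticalField E M :=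
  LinearMap.mk₂ _ (fun X V => T X ⁅(V : VectorField E M), S⁆)
    (fun X Y V => by rw [map_add, LinearMap.add_apply])
    (fun f X V => by rw [map_smul, LinearMap.smul_apply])
    (fun X V W => by rw [Submodule.coe_add, add_lie, map_add])
    (fun f X V => by
      rw [← map_smul]
      refine hT.congr rfl ?_
      rw [almostTangent_lie_of_semispray hS, almostTangent_smul, almostTangent_lie_of_semispray hS])

theorem IsSemibasic.descend_almostTangent {T : VerticalTensor E M} (hT : IsSemibasic T)
    (hS : almostTangent S = canonicalField) (X Y : VectorField E M) :
    hT.descend hS X (almostTangent Y) = T X Y :=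
  hT.congr rfl (almostTangent_lie_of_semispray hS _)

/-- The tensor field `(X, 𝒥Y) ↦ 𝒞(ℱX, Y) + 𝒞'(X, Y)`. -/
def tensorOfPair (hJ : almostTangent S = canonicalField) (p : SemibasicPair S) :
    VectorField E M →ₗ[SmoothFun E M] VerticalField E M →ₗ[SmoothFun E M] VerticalField E M :=
  p.2.1.descend hJ ∘ₗ almostComplexStructure hJ + p.2.2.1.descend hJ

theorem tensorOfPair_almostTangent (hJ : almostTangent S = canonicalField) (p : SemibasicPair S)
    (X Y : VectorField E M) : tensorOfPair hJ p X (almostTangent Y) =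
      p.1.1 (almostComplexStructure hJ X) Y + p.1.2 X Y :=
  congrArg₂ (· + ·) (p.2.1.descend_almostTangent hJ (almostComplexStructure hJ X) Y)
    (p.2.2.1.descend_almostTangent hJ X Y)

theorem tensorOfPair_canonicalField (hJ : almostTangent S = canonicalField) (p : SemibasicPair S)
    (X : VectorField E M) : tensorOfPair hJ p X canonicalField = 0 := by
  have h := tensorOfPair_almostTangent hJ p X S
  rw [hJ] at h
  exact h.trans ((congrArg₂ (· + ·) (p.2.2.2.1 _) (p.2.2.2.2 _)).trans (add_zero _))

theorem isLift_translate_tensorOfPair (p : SemibasicPair S) :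
    IsLift S ((berwald hS.almostTangent_eq).translate (tensorOfPair hS.almostTangent_eq p)) :=
  (isLift_iff hS).2 fun X => (congrArg₂ (· + ·) (berwald_canonicalField hS X)
    (tensorOfPair_canonicalField hS.almostTangent_eq p X)).trans (add_zero _)

/-- The lift of `Γ_S` determined by a pair of semi-basic tensor fields. -/
def liftOfPair (p : SemibasicPair S) : Lift S :=
  ⟨(berwald hS.almostTangent_eq).translate (tensorOfPair hS.almostTangent_eq p),
    isLift_translate_tensorOfPair hS p⟩

theorem liftOfPair_almostTangent (p : SemibasicPair S) (X Y : VectorField E M) :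
    (liftOfPair hS p).1 X (almostTangent Y) =
      berwald hS.almostTangent_eq X (almostTangent Y) +
        p.1.1 (almostComplexStructure hS.almostTangent_eq X) Y + p.1.2 X Y :=
  (congrArg (_ + ·) (tensorOfPair_almostTangent hS.almostTangent_eq p X Y)).trans
    (add_assoc _ _ _).symm

/-- On `𝒥X` only `𝒞` survives: `𝒞'(𝒥X, Y) = 0`, and `ℱ𝒥X = ℋX` has the same image under `𝒥` as `X`.
-/
theorem liftOfPair_vertical (p : SemibasicPair S) (X Y : VectorField E M) :
    (liftOfPair hS p).1 (almostTangent X) (almostTangent Y) =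
      berwald hS.almostTangent_eq (almostTangent X) (almostTangent Y) + p.1.1 X Y := by
  have hJ := hS.almostTangent_eq
  have h₁ : p.1.1 (almostComplexStructure hJ (almostTangent X)) Y = p.1.1 X Y := by
    rw [(isAlmostComplexStructure_almostComplexStructure hJ).comp_almostTangent]
    exact p.2.1.congr (almostTangent_horizontalPart hJ X) rfl
  have h₂ : p.1.2 (almostTangent X) Y = 0 := p.2.2.1 _ _ (.inl (almostTangent X).2)
  exact (liftOfPair_almostTangent hS p _ Y).trans
    ((congrArg₂ (· + ·) (congrArg (_ + ·) h₁) h₂).trans (add_zero _))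

/-- On `ℋX` only `𝒞'` survives, since `ℱℋX = -𝒥X` is vertical. -/
theorem liftOfPair_horizontal (p : SemibasicPair S) (X Y : VectorField E M) :
    (liftOfPair hS p).1 (horizontalPart S X) (almostTangent Y) =
      berwald hS.almostTangent_eq (horizontalPart S X) (almostTangent Y) + p.1.2 X Y := by
  have hJ := hS.almostTangent_eq
  have h₁ : p.1.1 (almostComplexStructure hJ (horizontalPart S X)) Y = 0 := by
    rw [(isAlmostComplexStructure_almostComplexStructure hJ).comp_horizontal]
    exact p.2.1 _ _ (.inl (-almostTangent X).2)
  have h₂ : p.1.2 (horizontalPart S X) Y = p.1.2 X Y :=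
    p.2.2.1.congr (almostTangent_horizontalPart hJ X) rfl
  exact (liftOfPair_almostTangent hS p _ Y).trans
    (congrArg₂ (· + ·) ((congrArg (_ + ·) h₁).trans (add_zero _)) h₂)

/-- The pair of semi-basic tensor fields determined by a lift of `Γ_S`. -/
def pairOfLift (D : Lift S) : SemibasicPair S :=
  let T := LinearConnection.difference D.1 (berwald hS.almostTangent_eq)
  ⟨((T ∘ₗ (VerticalField E M).subtype ∘ₗ almostTangentHom).compl₂ almostTangentHom,
    (T ∘ₗ horizontalHom S).compl₂ almostTangentHom), by
    have hJ := hS.almostTangent_eq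
    -- Both connections are lifts and send `C` to `𝒱X`. As `C = 𝒥S`, this becomes the vanishing of
    -- the two tensors at `S`.
    have hT (X : VectorField E M) : T X canonicalField = 0 := by
      rw [LinearConnection.difference_apply, (isLift_iff hS).1 D.2, berwald_canonicalField hS,
        sub_self]
    refine ⟨fun X Y h => ?_, fun X Y h => ?_, fun X => ?_, fun X => ?_⟩
    · change T (almostTangent X) (almostTangent Y) = 0
      rcases h with h | h
      · rw [almostTangent_eq_zero_iff.2 h, ZeroMemClass.coe_zero, map_zero, LinearMap.zero_apply]
      · rw [almostTangent_eq_zero_iff.2 h, map_zero]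
    · change T (horizontalPart S X) (almostTangent Y) = 0
      rcases h with h | h
      · rw [show horizontalPart S X = 0 from horizontalPart_vertical hJ ⟨X, h⟩, map_zero,
          LinearMap.zero_apply]
      · rw [almostTangent_eq_zero_iff.2 h, map_zero]
    · change T (almostTangent X) (almostTangent S) = 0
      rw [hJ, hT]
    · change T (horizontalPart S X) (almostTangent S) = 0
      rw [hJ, hT]⟩

theorem pairOfLift_fst (D : Lift S) (X Y : VectorField E M) :
    (pairOfLift hS D).1.1 X Y = D.1 (almostTangent X) (almostTangent Y) -
      berwald hS.almostTangent_eq (almostTangent X) (almostTangent Y) := rfl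

theorem pairOfLift_snd (D : Lift S) (X Y : VectorField E M) :
    (pairOfLift hS D).1.2 X Y = D.1 (horizontalPart S X) (almostTangent Y) -
      berwald hS.almostTangent_eq (horizontalPart S X) (almostTangent Y) := rfl

/-- Lifts of `Γ_S` correspond to pairs of semi-basic tensor fields annihilated by `S`. -/
def liftEquivPair : Lift S ≃ SemibasicPair S where
  toFun := pairOfLift hS
  invFun := liftOfPair hS
  left_inv D := Subtype.ext <| LinearConnection.ext_almostTangent hS.almostTangent_eq
    (fun X Y => (liftOfPair_vertical hS _ X Y).trans
      ((congrArg (_ + ·) (pairOfLift_fst hS D X Y)).trans (add_sub_cancel _ _)))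
    (fun X Y => (liftOfPair_horizontal hS _ X Y).trans
      ((congrArg (_ + ·) (pairOfLift_snd hS D X Y)).trans (add_sub_cancel _ _)))
  right_inv p := Subtype.ext <| Prod.ext
    (LinearMap.ext₂ fun X Y => (pairOfLift_fst hS _ X Y).trans
      ((congrArg (· - _) (liftOfPair_vertical hS p X Y)).trans (add_sub_cancel_left _ _)))
    (LinearMap.ext₂ fun X Y => (pairOfLift_snd hS _ X Y).trans
      ((congrArg (· - _) (liftOfPair_horizontal hS p X Y)).trans (add_sub_cancel_left _ _)))

end Spray
end Connections
end SprayGeometry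
end

/-- The lifts of the canonical connection `Γ_S` of a spray `S` correspond bijectively to the pairs
`(𝒞, 𝒞')` of semi-basic `𝒱TM`-valued tensor fields with `𝒞(·, S) = 𝒞'(·, S) = 0`, by
`∇ = ∇* + 𝒞(ℱ·, ·) + 𝒞'`. -/
theorem mainTheorem12 {E : Type*} [NormedAddCommGroup E] [NormedSpace ℝ E] [FiniteDimensional ℝ E]
    {M : Type*} [TopologicalSpace M] [T2Space M] [SecondCountableTopology M] [ChartedSpace E M]
    [IsManifold 𝓘(ℝ, E) ∞ M]
    (S : SprayGeometry.VectorField E M) (hS : SprayGeometry.IsSpray S) :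
    ∃ (F : SprayGeometry.VectorField E M →ₗ[SprayGeometry.SmoothFun E M]
          SprayGeometry.VectorField E M)
      (B : SprayGeometry.LinearConnection E M),
      (SprayGeometry.IsAlmostComplexStructure S F ∧
        ∀ F', SprayGeometry.IsAlmostComplexStructure S F' → F' = F) ∧
      (SprayGeometry.IsBerwald S B ∧ SprayGeometry.IsLift S B ∧
        ∀ B', SprayGeometry.IsBerwald S B' → B' = B) ∧
      ∃ Φ : SprayGeometry.Lift S ≃ SprayGeometry.SemibasicPair S,
        ∀ (D : SprayGeometry.Lift S) (X Y : SprayGeometry.VectorField E M),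
          D.1 X (SprayGeometry.almostTangent Y) =
              B X (SprayGeometry.almostTangent Y) + (Φ D).1.1 (F X) Y + (Φ D).1.2 X Y ∧
          (Φ D).1.1 X Y = D.1.torsion (SprayGeometry.almostTangent X) Y ∧
          ((Φ D).1.2 X Y : SprayGeometry.VectorField E M) =
            D.1 (SprayGeometry.horizontalPart S X) (SprayGeometry.almostTangent Y) -
              SprayGeometry.verticalPart S
                (SprayGeometry.lieBracket (SprayGeometry.horizontalPart S X)
                  (SprayGeometry.almostTangent Y)) := by
  have hJ := hS.almostTangent_eq
  open SprayGeometry in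
  refine ⟨almostComplexStructure hJ, berwald hJ,
    ⟨isAlmostComplexStructure_almostComplexStructure hJ, fun F' hF' =>
      hF'.unique hJ (isAlmostComplexStructure_almostComplexStructure hJ)⟩,
    ⟨isBerwald_berwald hJ, isLift_berwald hS, fun B' hB' => hB'.unique hJ (isBerwald_berwald hJ)⟩,
    liftEquivPair hS, fun D X Y => ⟨?_, ?_, ?_⟩⟩
  · conv_lhs => rw [← (liftEquivPair hS).symm_apply_apply D]
    exact liftOfPair_almostTangent hS _ X Y
  -- In the torsion, `𝒥𝒥X = 0` removes the middle term, and `𝒥[𝒥X, Y]` is the Berwald derivative.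
  · refine (pairOfLift_fst hS D X Y).trans ?_
    rw [berwald_almostTangent, LinearConnection.torsion, almostTangent_vertical,
      LinearConnection.zero_right, sub_zero]
  · refine (congrArg Subtype.val (pairOfLift_snd hS D X Y)).trans ?_
    rw [berwald_horizontalPart, ← coe_verticalHom hJ]
    rfl
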